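/- Let $q$ be a prime power. Represent the affine points $(\alpha,\beta,1)$ of $\mathrm{PG}(2,q^3)\setminus\ell_\infty$, where $\ell_\infty$ is the line $z=0$, by the points $([\alpha],[\beta],1)$ of $\mathrm{PG}(6,q)\setminus\Sigma_\infty$, where $\Sigma_\infty$ is the hyperplane $z=0$ and $[\alpha]\in\mathbb F_q^3$ is the coordinate vector of $\alpha\in\mathbb F_{q^3}$ in a fixed $\mathbb F_q$-basis of $\mathbb F_{q^3}$ (the Bruck–Bose representation); for a set $X$ of affine points, $[X]$ is its image. A point $T=(\alpha,\beta,0)$ of $\ell_\infty$ corresponds to the plane $[T]=\{([\alpha x],[\beta x],0):x\in\mathbb F_{q^3}^*\}$ of $\Sigma_\infty$, and these planes form a regular 2-spread $\mathcal S$ of $\Sigma_\infty$. *Special conics.* Let $\pi$ be an order-$q$-subplane of $\mathrm{PG}(2,q^3)$ (an image of $\mathrm{PG}(2,q)$ under a homography) that is exterior to $\ell_\infty$, i.e. has no point on $\ell_\infty$. A $(\pi,\ell_\infty)$-special conic is a conic of $\pi$ whose extension to $\mathrm{PG}(2,q^3)$ contains the fixed points of the group $\mathrm{PGL}(3,q^3)_{\pi,\ell_\infty}$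 of all homographies that fix $\pi$ and $\ell_\infty$. *Special twisted cubics.* For a set $\mathbb X$ of planes of $\Sigma_\infty$, a transversal line of $\mathbb X$ is a line of the extension of $\Sigma_\infty$ to $\mathrm{PG}(5,q^3)$ that meets the extension of every plane of $\mathbb X$. An $\mathbb X$-special twisted cubic is a twisted cubic in a 3-space of $\mathrm{PG}(6,q)$ that contains a plane of $\mathbb X$ and is not contained in $\Sigma_\infty$, such that $\mathbb X$ has exactly three transversal lines and the extension of the twisted cubic to $\mathrm{PG}(6,q^3)$ meets each of them. *Covers.* The exterior splash of $\pi$ is the set $\mathbb S$ of the points of $\ell_\infty$ that lie on an extended line of $\pi$, also regarded as a set of planes of $\mathcal S$. A cover of $\mathbb S$ is a set of $q^2+q+1$ mutually disjoint planes of $\Sigma_\infty$ that covers the same points as the planes of $\mathbb S$, each of them meeting every plane of $\mathbb S$ in exactly one point; $\mathbb S$ has exactly two covers. The tangent plane of $[\pi]$ at a point $P$ of $\pi$ is the span of the tangent lines at $[P]$ to the $\mathcal S$-special twisted cubics $[m\cap\pi]$, for the lines $m$ of $\pi$ through $P$. The tangent cover of $\pi$ is the cover of $\mathbb S$ such that every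 tangent plane of $[\pi]$ meets $\Sigma_\infty$ inside one of its planes, and the conic cover of $\pi$ is the other cover of $\mathbb S$. **Theorem.** Let $\pi$ be an order-$q$-subplane of $\mathrm{PG}(2,q^3)$ exterior to $\ell_\infty$, with conic cover $\mathbb C$. If $\mathcal C$ is a $(\pi,\ell_\infty)$-special conic of $\pi$, then $[\mathcal C]$ is the set of points of a $\mathbb C$-special twisted cubic of $\mathrm{PG}(6,q)$. In particular, the extension of this twisted cubic to $\mathrm{PG}(6,q^3)$ meets the three transversal lines of $\mathbb C$. -/

import Mathlib

open scoped LinearAlgebra.Projectivization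

noncomputable section

namespace BruckBose

/-! ## The plane `PG(2,q³)`, its order-`q`-subplanes and their special conics

`F` is the field of order `q`, and `K` is its cubic extension. -/

/-- Homogeneous coordinate vectors `(x, y, z)` of `PG(2,k)`. -/
abbrev Vec3 (k : Type*) := Fin 3 → k

/-- The point `P` lies on the subspace `W`. -/
def OnSubspace {k V : Type*} [Field k] [AddCommGroup V] [Module k V]
    (P : ℙ k V) (W : Submodule k V) : Prop :=
  P.submodule ≤ W

/-- The line `z = 0` of `PG(2,K)`. -/
def lineAtInfinity (K : Type*) [Field K] : Submodule K (Vec3 K) :=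
  LinearMap.ker (LinearMap.proj (R := K) (φ := fun _ : Fin 3 => K) 2)

/-- The image of a point of `PG(2,K)` under the homography induced by `h`. -/
def homography {K : Type*} [Field K] (h : Vec3 K ≃ₗ[K] Vec3 K) (P : ℙ K (Vec3 K)) :
    ℙ K (Vec3 K) :=
  Projectivization.map h.toLinearMap h.injective P

/-- The canonical subplane `PG(2,F)` of `PG(2,K)`: the points with coordinates in `F`. -/
def canonicalSubplane (F K : Type*) [Field F] [Field K] [Algebra F K] : Set (ℙ K (Vec3 K)) :=
  {P | ∃ x : Vec3 F, ∃ hx : (fun i => algebraMap F K (x i)) ≠ (0 : Vec3 K),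
    P = Projectivization.mk K _ hx}

/-- The homography `h` coordinatises `π`: it maps `PG(2,F)` onto `π`. -/
def Coordinatises (F : Type*) {K : Type*} [Field F] [Field K] [Algebra F K]
    (h : Vec3 K ≃ₗ[K] Vec3 K) (π : Set (ℙ K (Vec3 K))) : Prop :=
  π = homography h '' canonicalSubplane F K

/-- An order-`q`-subplane of `PG(2,q³)`, as a set of points: an image of `PG(2,q)` under a
homography. -/
def IsSubplane (F : Type*) {K : Type*} [Field F] [Field K] [Algebra F K]
    (π : Set (ℙ K (Vec3 K))) : Prop :=
  ∃ h : Vec3 K ≃ₗ[K] Vec3 K, Coordinatises F h π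

/-- No point of `π` lies on the line `l`. -/
def IsExteriorTo {K : Type*} [Field K] (π : Set (ℙ K (Vec3 K))) (l : Submodule K (Vec3 K)) :
    Prop :=
  ∀ P ∈ π, ¬ OnSubspace P l

/-- `m` is the extension to `PG(2,K)` of a line of `π`: a line with two distinct points of `π`. -/
def IsExtendedLine {K : Type*} [Field K] (π : Set (ℙ K (Vec3 K))) (m : Submodule K (Vec3 K)) :
    Prop :=
  Module.finrank K m = 2 ∧ ∃ P ∈ π, ∃ Q ∈ π, P ≠ Q ∧ OnSubspace P m ∧ OnSubspace Q m

/-- The splash of `π` on `l`: the points of `l` that lie on an extended line of `π`. -/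
def splash {K : Type*} [Field K] (π : Set (ℙ K (Vec3 K))) (l : Submodule K (Vec3 K)) :
    Set (ℙ K (Vec3 K)) :=
  {T | OnSubspace T l ∧ ∃ m, IsExtendedLine π m ∧ OnSubspace T m}

/-- The points of `PG(2,K)` fixed by every homography that fixes `π` (as a set) and the line `l`,
that is, the fixed points of the group `PGL(3,q³)_{π,l}`. -/
def fixedPoints {K : Type*} [Field K] (π : Set (ℙ K (Vec3 K))) (l : Submodule K (Vec3 K)) :
    Set (ℙ K (Vec3 K)) :=
  {E | ∀ g : Vec3 K ≃ₗ[K] Vec3 K, homography g '' π = π → l.map g.toLinearMap = l →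
    homography g E = E}

/-- For a quadratic form `Q` over `F`, the points `P` of `PG(2,K)` such that the coordinates of `P`
with respect to `h` satisfy `Q = 0`. (Whether `Q` vanishes does not depend on the
representative.) -/
def extendedConic {F K : Type*} [Field F] [Field K] [Algebra F K]
    (h : Vec3 K ≃ₗ[K] Vec3 K) (Q : MvPolynomial (Fin 3) F) : Set (ℙ K (Vec3 K)) :=
  {P | MvPolynomial.aeval (h.symm P.rep) Q = 0}

/-- A `(π,l)`-special conic of `π`: the set of points of `π` on a conic of `π` whose extension to
`PG(2,K)` contains the fixed points of `PGL(3,q³)_{π,l}`. -/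
def IsSpecialConic (F : Type*) {K : Type*} [Field F] [Field K] [Algebra F K]
    (π : Set (ℙ K (Vec3 K))) (l : Submodule K (Vec3 K)) (C : Set (ℙ K (Vec3 K))) : Prop :=
  ∃ (h : Vec3 K ≃ₗ[K] Vec3 K) (Q : MvPolynomial (Fin 3) F),
    Coordinatises F h π ∧ Q ≠ 0 ∧ Q.IsHomogeneous 2 ∧
      fixedPoints π l ⊆ extendedConic h Q ∧ C = π ∩ extendedConic h Q

/-! ## The space `PG(6,q)`, its cubic extension, and the Bruck–Bose map -/

/-- Homogeneous coordinate vectors `(x₀,x₁,x₂,y₀,y₁,y₂,z)` of `PG(6,k)`, grouped as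
`((x₀,x₁,x₂),(y₀,y₁,y₂),z)`. -/
abbrev Vec7 (k : Type*) := (Fin 3 → k) × (Fin 3 → k) × k

/-- The hyperplane `z = 0` of `PG(6,k)`. -/
def sigmaInfinity (k : Type*) [Field k] : Submodule k (Vec7 k) :=
  LinearMap.ker ((LinearMap.snd k (Fin 3 → k) k).comp
    (LinearMap.snd k (Fin 3 → k) ((Fin 3 → k) × k)))

/-- The inclusion of the coordinate vectors of `PG(6,F)` in those of `PG(6,K)`. -/
def extendVec {F : Type*} (K : Type*) [Field F] [Field K] [Algebra F K] (w : Vec7 F) : Vec7 K :=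
  (fun i => algebraMap F K (w.1 i), fun i => algebraMap F K (w.2.1 i), algebraMap F K w.2.2)

/-- The extension to `PG(6,K)` of a subspace of `PG(6,F)`. -/
def extendSubspace {F : Type*} (K : Type*) [Field F] [Field K] [Algebra F K]
    (W : Submodule F (Vec7 F)) : Submodule K (Vec7 K) :=
  Submodule.span K (extendVec K '' (W : Set (Vec7 F)))

/-- The Bruck–Bose image `[X]` of a set `X` of affine points of `PG(2,K)`: the point `(α,β,1)`
corresponds to `([α],[β],1)`, where `[α]` is the coordinate vector of `α` in the basis `b`. -/
def bruckBose {F K : Type*} [Field F] [Field K] [Algebra F K] (b : Module.Basis (Fin 3) F K)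
    (X : Set (ℙ K (Vec3 K))) : Set (ℙ F (Vec7 F)) :=
  {R | ∃ (α β : K) (hP : (![α, β, 1] : Vec3 K) ≠ 0)
    (hR : ((b.equivFun α, b.equivFun β, 1) : Vec7 F) ≠ 0),
    Projectivization.mk K _ hP ∈ X ∧ R = Projectivization.mk F _ hR}

/-- The map `(α,β,γ) ↦ ([α],[β],0)`. -/
def toInfinity {F K : Type*} [Field F] [Field K] [Algebra F K] (b : Module.Basis (Fin 3) F K) :
    Vec3 K →ₗ[F] Vec7 F :=
  (b.equivFun.toLinearMap.comp (LinearMap.proj (R := F) (φ := fun _ : Fin 3 => K) 0)).prod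
    ((b.equivFun.toLinearMap.comp (LinearMap.proj (R := F) (φ := fun _ : Fin 3 => K) 1)).prod 0)

/-- The plane `[T] = {([αx],[βx],0)}` of `PG(6,F)` that corresponds to the point `T = (α,β,0)` of
the line at infinity. -/
def spreadPlane {F K : Type*} [Field F] [Field K] [Algebra F K] (b : Module.Basis (Fin 3) F K)
    (T : ℙ K (Vec3 K)) : Submodule F (Vec7 F) :=
  (T.submodule.restrictScalars F).map (toInfinity b)

/-- The regular 2-spread of the Bruck–Bose representation. -/
def spread {F K : Type*} [Field F] [Field K] [Algebra F K] (b : Module.Basis (Fin 3) F K) :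
    Set (Submodule F (Vec7 F)) :=
  spreadPlane b '' {T | OnSubspace T (lineAtInfinity K)}

/-- The splash of `π` on the line at infinity, as a set of planes of `PG(6,F)`. -/
def splashPlanes {F K : Type*} [Field F] [Field K] [Algebra F K] (b : Module.Basis (Fin 3) F K)
    (π : Set (ℙ K (Vec3 K))) : Set (Submodule F (Vec7 F)) :=
  spreadPlane b '' splash π (lineAtInfinity K)

/-! ## Twisted cubics -/

/-- The vector `s³ m₀ + s²t m₁ + st² m₂ + t³ m₃`. -/
def cubicVec {k V : Type*} [Field k] [AddCommGroup V] [Module k V] (m : Fin 4 → V) (s t : k) : V :=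
  s ^ 3 • m 0 + (s ^ 2 * t) • m 1 + (s * t ^ 2) • m 2 + t ^ 3 • m 3

/-- A twisted cubic of `PG(6,F)`: the curve `(s,t) ↦ s³ m₀ + s²t m₁ + st² m₂ + t³ m₃` with
`m₀, m₁, m₂, m₃` linearly independent over `F`. -/
structure TwistedCubic (F : Type*) [Field F] where
  m : Fin 4 → Vec7 F
  indep : LinearIndependent F m

namespace TwistedCubic

variable {F : Type*} [Field F]

/-- The points of the twisted cubic. -/
def points (N : TwistedCubic F) : Set (ℙ F (Vec7 F)) :=
  {P | ∃ (s t : F) (h : cubicVec N.m s t ≠ 0), P = Projectivization.mk F _ h}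

/-- The points of the extension of the twisted cubic to `PG(6,K)`. -/
def extendedPoints (K : Type*) [Field K] [Algebra F K] (N : TwistedCubic F) :
    Set (ℙ K (Vec7 K)) :=
  {P | ∃ (s t : K) (h : cubicVec (fun i => extendVec K (N.m i)) s t ≠ 0),
    P = Projectivization.mk K _ h}

/-- The 3-space that contains the twisted cubic. -/
def space (N : TwistedCubic F) : Submodule F (Vec7 F) :=
  Submodule.span F (Set.range N.m)

/-- The tangent line at the point with parameters `(s,t)`. It is spanned by that point and the
two partial derivatives of the parametrisation. (The point itself is listed since in
characteristic three it need not be a combination of the derivatives.) -/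
def tangent (N : TwistedCubic F) (s t : F) : Submodule F (Vec7 F) :=
  Submodule.span F {cubicVec N.m s t,
    (3 * s ^ 2) • N.m 0 + (2 * s * t) • N.m 1 + t ^ 2 • N.m 2,
    s ^ 2 • N.m 1 + (2 * s * t) • N.m 2 + (3 * t ^ 2) • N.m 3}

end TwistedCubic

/-- The transversal lines of a set `X` of planes of the hyperplane at infinity of `PG(6,F)`: the
lines of the hyperplane at infinity of `PG(6,K)` that meet the extension of every plane of `X`. -/
def transversals {F : Type*} (K : Type*) [Field F] [Field K] [Algebra F K]
    (X : Set (Submodule F (Vec7 F))) : Set (Submodule K (Vec7 K)) :=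
  {g | Module.finrank K g = 2 ∧ g ≤ sigmaInfinity K ∧ ∀ α ∈ X, g ⊓ extendSubspace K α ≠ ⊥}

/-- `N` is an `X`-special twisted cubic: it lies in a 3-space, not contained in the hyperplane at
infinity, about a plane of `X`, and its extension to `PG(6,K)` meets the three transversal lines
of `X`. -/
def IsSpecialCubic {F : Type*} (K : Type*) [Field F] [Field K] [Algebra F K]
    (X : Set (Submodule F (Vec7 F))) (N : TwistedCubic F) : Prop :=
  ¬ N.space ≤ sigmaInfinity F ∧ (∃ α ∈ X, α ≤ N.space) ∧
    (transversals K X).ncard = 3 ∧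
      ∀ g ∈ transversals K X, ∃ P ∈ N.extendedPoints K, OnSubspace P g

/-! ## The covers of an exterior splash -/

/-- `X` is a cover (switching set) of the set `S` of planes: it consists of `q² + q + 1` mutually
disjoint planes of the hyperplane at infinity, covers the same points as `S`, and each of its planes
meets each plane of `S` in a unique point. -/
def IsCover {F : Type*} [Field F] (S X : Set (Submodule F (Vec7 F))) : Prop :=
  X.ncard = Nat.card F ^ 2 + Nat.card F + 1 ∧
    (∀ α ∈ X, Module.finrank F α = 3 ∧ α ≤ sigmaInfinity F) ∧
    (∀ α ∈ X, ∀ β ∈ X, α ≠ β → α ⊓ β = ⊥) ∧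
    (⋃ α ∈ X, (α : Set (Vec7 F))) = (⋃ σ ∈ S, (σ : Set (Vec7 F))) ∧
    ∀ α ∈ X, ∀ σ ∈ S, Module.finrank F (α ⊓ σ : Submodule F (Vec7 F)) = 1

/-- The tangent plane of `[π]` at the point `P` of `π`: the span of the tangent lines at `[P]` to the
twisted cubics `[m ∩ π]`, for the lines `m` of `π` through `P`. (A line of `π`, exterior to the line
at infinity, corresponds to a twisted cubic that is special with respect to the regular spread;
being special makes the cubic unique also for small `q`, where the `q + 1` points do not
determine it.) -/
def tangentPlane {F K : Type*} [Field F] [Field K] [Algebra F K] (b : Module.Basis (Fin 3) F K)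
    (π : Set (ℙ K (Vec3 K))) (P : ℙ K (Vec3 K)) : Submodule F (Vec7 F) :=
  sSup {L | ∃ (m : Submodule K (Vec3 K)) (N : TwistedCubic F) (s t : F)
    (h : cubicVec N.m s t ≠ 0),
    IsExtendedLine π m ∧ OnSubspace P m ∧
    IsSpecialCubic K (spread b) N ∧
    N.points = bruckBose b {Q | Q ∈ π ∧ OnSubspace Q m} ∧
    bruckBose b {P} = {Projectivization.mk F _ h} ∧
    L = N.tangent s t}

/-- `T` is the tangent cover of `π`: the cover of the exterior splash of `π` such that each tangent
plane of `[π]` meets the hyperplane at infinity inside a plane of `T`. -/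
def IsTangentCover {F K : Type*} [Field F] [Field K] [Algebra F K] (b : Module.Basis (Fin 3) F K)
    (π : Set (ℙ K (Vec3 K))) (T : Set (Submodule F (Vec7 F))) : Prop :=
  IsCover (splashPlanes b π) T ∧
    ∀ P ∈ π, ∃ α ∈ T, tangentPlane b π P ⊓ sigmaInfinity F ≤ α

/-- `C` is the conic cover of `π`: the cover of the exterior splash of `π` other than the tangent
cover of `π`. -/
def IsConicCover {F K : Type*} [Field F] [Field K] [Algebra F K] (b : Module.Basis (Fin 3) F K)
    (π : Set (ℙ K (Vec3 K))) (C : Set (Submodule F (Vec7 F))) : Prop :=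
  IsCover (splashPlanes b π) C ∧ ∃ T, IsTangentCover b π T ∧ C ≠ T

end BruckBose

end

/-!
Write `q = |F|`, let `σ` be the Frobenius map `x ↦ x ^ q` of `K` and `N(x) = x σ(x) σ²(x)` the norm.

Since `π` is exterior, the equation of the line at infinity identifies the vectors of `F³` with `K`.
Extending scalars, `x ∈ K` becomes `(x, σ x, σ² x) ∈ K³`, and `π` is the set of the points
`H (x, σ x, σ² x)` for a linear map `H` under which the line at infinity is `X₀ = 0`
(`exists_isFrame`). A homography that fixes `π` and the line at infinity is diagonal in these
coordinates, so the coordinate points are fixed points and a special conic has an equation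
`Tr(κ / x) = 0` (`exists_special_conic_equation`). With `y = 1 / x`, which runs over a
two-dimensional `F`-space, the points of the conic are `(N(y), y² σ²(y), y² σ(y))`: a cubic curve in
`PG(6,F)` (`points_conic`). Over `K` the conjugates of `y` become three different linear forms in the
parameters, and at the root of one of them all but one coordinate of either kind vanish
(`isSpecialCubic_cubic`).

At infinity, write points of `PG(5,F)` as `(β, γ) ∈ K²`. The exterior splash consists of the planes
`γ = θ β` with `N(θ) = -1` (`splashPlanes_eq`). A plane of a cover is the graph of an `F`-linear map
`f` such that `f - θ` is singular for all these `θ`; expanding the Dickson determinant of `f - θ` as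
a function of `θ` shows that `f` is `θ' σ` or `θ' σ²`, and the covers are the two families
`γ = θ σ(β)` and `γ = θ σ²(β)` (`cover_eq`). Explicit tangent directions to the cubics of the lines
of `π` rule out the first family as tangent cover, so it is the conic cover (`conicCover_eq`).

Finally, a line over `K` that meets the extensions of all planes `γ = θ σ(β)` yields rank conditions
that are polynomial in `θ`. The functions `1, θ, σ(θ), θ σ(θ)` on the elements of norm `-1` are
independent, so each coefficient vanishes, and this leaves three lines spanned by coordinate points
(`transversals_subset`). These are the lines that the extended cubic meets.
-/

open scoped LinearAlgebra.Projectivization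

noncomputable section

namespace BruckBose

/-! ### The Frobenius map of a cubic extension of finite fields -/

section Frobenius

variable (F K : Type*) [Field F] [Finite F] [Field K] [Algebra F K]

/-- The Frobenius automorphism `x ↦ x ^ q` of `K` over `F`, where `q` is the order of `F`. -/
def frob [Algebra.IsAlgebraic F K] : K ≃ₐ[F] K :=
  letI := Fintype.ofFinite F
  FiniteField.frobeniusAlgEquivOfAlgebraic F K

theorem frob_apply [Algebra.IsAlgebraic F K] (x : K) : frob F K x = x ^ Nat.card F := by
  let := Fintype.ofFinite F
  rw [Nat.card_eq_fintype_card]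
  rfl

variable [hdeg : Fact (Module.finrank F K = 3)]

instance : FiniteDimensional F K :=
  FiniteDimensional.of_finrank_pos (by rw [hdeg.out]; norm_num)

local notation "σ" => frob F K

theorem natCard_ext : Nat.card K = Nat.card F ^ 3 := by
  rw [Module.natCard_eq_pow_finrank (K := F) (V := K), hdeg.out]

theorem frob_cube (x : K) : σ (σ (σ x)) = x := by
  have : Finite K := Module.finite_of_finite F
  let := Fintype.ofFinite K
  simp only [frob_apply, ← pow_mul]
  have h := FiniteField.pow_card x
  rw [← Nat.card_eq_fintype_card, natCard_ext F K] at h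
  convert h using 2
  ring

variable {F K}

/-- The fixed field of the Frobenius map is `F`: the polynomial `X ^ q - X` has at most `q` roots
in `K`. -/
theorem exists_algebraMap_eq {x : K} (hx : σ x = x) : ∃ c : F, algebraMap F K c = x := by
  classical
  let := Fintype.ofFinite F
  by_contra hc
  push Not at hc
  have hq : 1 < Nat.card F := Finite.one_lt_card
  let p : Polynomial K := Polynomial.X ^ Nat.card F - Polynomial.X
  have hp : p ≠ 0 := FiniteField.X_pow_card_sub_X_ne_zero K hq
  let s : Finset K := insert x (Finset.univ.map ⟨algebraMap F K, (algebraMap F K).injective⟩)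
  have hs : s.card = Nat.card F + 1 := by
    rw [Finset.card_insert_of_notMem, Finset.card_map, Finset.card_univ, Nat.card_eq_fintype_card]
    simpa using hc
  have hsub : s.val ⊆ p.roots := by
    intro y hy
    rw [Polynomial.mem_roots hp]
    have hy' : y = x ∨ ∃ c : F, algebraMap F K c = y := by simpa [s] using hy
    rcases hy' with rfl | ⟨c, rfl⟩
    · rw [frob_apply] at hx
      simp only [p, Polynomial.IsRoot.def, Polynomial.eval_sub, Polynomial.eval_pow,
        Polynomial.eval_X, hx, sub_self]
    · simp [p, ← map_pow, Nat.card_eq_fintype_card, FiniteField.pow_card]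
  have h1 := Polynomial.card_le_degree_of_subset_roots hsub
  rw [hs, FiniteField.X_pow_card_sub_X_natDegree_eq K hq] at h1
  omega

theorem exists_frob_ne : ∃ v : K, σ v ≠ v := by
  by_contra! h
  have hb : (⊥ : Subalgebra F K) = ⊤ := by
    rw [eq_top_iff]
    intro x _
    obtain ⟨c, hc⟩ := exists_algebraMap_eq (h x)
    exact Algebra.mem_bot.2 ⟨c, hc⟩
  have h1 := Subalgebra.bot_eq_top_iff_finrank_eq_one.1 hb
  rw [hdeg.out] at h1
  omega

/-- Independence of the three automorphisms `1`, `σ`, `σ²`. -/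
theorem eq_zero_of_forall_linear {a b c : K}
    (h : ∀ x : K, a * x + b * σ x + c * σ (σ x) = 0) : a = 0 ∧ b = 0 ∧ c = 0 := by
  obtain ⟨v, hv⟩ := exists_frob_ne (F := F) (K := K)
  have h1 : ∀ x, a * (σ (σ v) - v) * x + b * (σ (σ v) - σ v) * σ x = 0 := fun x => by
    have := h (v * x)
    simp only [map_mul] at this
    linear_combination σ (σ v) * h x - this
  have hv2 : σ (σ v) ≠ σ v := fun e => hv ((frob F K).injective e)
  have hv3 : σ (σ v) ≠ v := fun e => hv (by
    conv_rhs => rw [← frob_cube F K v, e])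
  have h2 : ∀ x, a * (σ (σ v) - v) * (σ v - v) * x = 0 := fun x => by
    have := h1 (v * x)
    simp only [map_mul] at this
    linear_combination σ v * h1 x - this
  have ha : a = 0 := by simpa [sub_eq_zero, hv, hv3] using h2 1
  subst ha
  have hb : b = 0 := by simpa [sub_eq_zero, hv2] using h1 1
  subst hb
  have hc := h 1
  simp at hc
  exact ⟨rfl, rfl, hc⟩

/-- Independence of the six products of conjugates of degree two, as functions on `K`. -/
theorem eq_zero_of_forall_quadratic {p₀ p₁ p₂ r₀ r₁ r₂ : K}
    (h : ∀ x : K, p₀ * x ^ 2 + p₁ * σ x ^ 2 + p₂ * σ (σ x) ^ 2 + r₀ * (σ x * σ (σ x)) +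
      r₁ * (x * σ (σ x)) + r₂ * (x * σ x) = 0) :
    p₀ = 0 ∧ p₁ = 0 ∧ p₂ = 0 ∧ r₀ = 0 ∧ r₁ = 0 ∧ r₂ = 0 := by
  -- By polarisation each `x` gives a linear relation between `y`, `σ y`, `σ² y`.
  have h1 : ∀ x y : K, (2 * p₀ * x + r₂ * σ x + r₁ * σ (σ x)) * y +
      (r₂ * x + 2 * p₁ * σ x + r₀ * σ (σ x)) * σ y +
      (r₁ * x + r₀ * σ x + 2 * p₂ * σ (σ x)) * σ (σ y) = 0 := fun x y => by
    have := h (x + y)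
    simp only [map_add] at this
    linear_combination this - h x - h y
  obtain ⟨e₀, e₂, e₁⟩ := eq_zero_of_forall_linear fun x => (eq_zero_of_forall_linear (h1 x)).1
  obtain ⟨-, f₁, e⟩ := eq_zero_of_forall_linear fun x => (eq_zero_of_forall_linear (h1 x)).2.1
  obtain ⟨-, -, f₂⟩ := eq_zero_of_forall_linear fun x => (eq_zero_of_forall_linear (h1 x)).2.2
  subst e₂ e₁ e
  have : Finite K := Module.finite_of_finite F
  by_cases h2 : (2 : K) = 0
  · -- In characteristic two every element of `K` is a square.
    have hchar : CharP K 2 := CharTwo.of_one_ne_zero_of_two_eq_zero one_ne_zero h2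
    have h3 : ∀ x : K, p₀ * x + p₁ * σ x + p₂ * σ (σ x) = 0 := fun x => by
      obtain ⟨y, rfl⟩ := FiniteField.isSquare_of_char_two (ringChar.eq K 2) x
      have := h y
      simp only [map_mul]
      linear_combination this
    obtain ⟨a, b, c⟩ := eq_zero_of_forall_linear h3
    exact ⟨a, b, c, rfl, rfl, rfl⟩
  · simp only [mul_eq_zero, h2, false_or] at e₀ f₁ f₂
    exact ⟨e₀, f₁, f₂, rfl, rfl, rfl⟩

variable (F) in
/-- The product of the three conjugates of an element, that is, its norm, as an element of `K`. -/
def conjNorm (x : K) : K := x * σ x * σ (σ x)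

theorem conjNorm_mul (x y : K) : conjNorm F (x * y) = conjNorm F x * conjNorm F y := by
  simp only [conjNorm, map_mul]; ring

theorem conjNorm_frob (x : K) : conjNorm F (σ x) = conjNorm F x := by
  simp only [conjNorm, frob_cube]; ring

theorem frob_conjNorm (x : K) : σ (conjNorm F x) = conjNorm F x := by
  simp only [conjNorm, map_mul, frob_cube]; ring

theorem conjNorm_eq_zero {x : K} : conjNorm F x = 0 ↔ x = 0 := by
  simp [conjNorm]

theorem conjNorm_neg (x : K) : conjNorm F (-x) = -conjNorm F x := by
  simp only [conjNorm, map_neg]; ring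

theorem conjNorm_frob_div {x : K} (hx : x ≠ 0) : conjNorm F (σ x / x) = 1 := by
  have h1 : σ x ≠ 0 := by simpa using hx
  have h2 : σ (σ x) ≠ 0 := by simpa using hx
  simp only [conjNorm, map_div₀, frob_cube]
  field_simp

theorem exists_algebraMap_eq_conjNorm (x : K) : ∃ c : F, algebraMap F K c = conjNorm F x :=
  exists_algebraMap_eq (frob_conjNorm x)

theorem conjNorm_eq_pow (x : K) :
    conjNorm F x = x ^ (Nat.card F ^ 2 + Nat.card F + 1) := by
  simp only [conjNorm, frob_apply]; ring

/-- Hilbert's theorem 90, by means of a Lagrange resolvent. -/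
theorem exists_frob_eq_mul {η : K} (h : conjNorm F η = 1) : ∃ z : K, z ≠ 0 ∧ σ z = η * z := by
  have hη : η ≠ 0 := fun h0 => by simp [conjNorm, h0] at h
  by_contra! hc
  have key : ∀ x : K, σ η * σ (σ η) * x + σ (σ η) * σ x + 1 * σ (σ x) = 0 := fun x => by
    by_contra hz
    refine hc _ hz ?_
    simp only [map_add, map_mul, map_one, frob_cube]
    simp only [conjNorm] at h
    linear_combination (-x) * h
  exact one_ne_zero (eq_zero_of_forall_linear key).2.2

end Frobenius

section Subplane

variable {F K : Type*} [Field F] [Finite F] [Field K] [Algebra F K]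
  [hdeg : Fact (Module.finrank F K = 3)]

local notation "σ" => frob F K

/-! ### Norms, traces and linear maps -/

variable (F K) in
theorem ncard_conjNorm_eq_neg_one_le :
    {θ : K | conjNorm F θ = -1}.Finite ∧
      {θ : K | conjNorm F θ = -1}.ncard ≤ Nat.card F ^ 2 + Nat.card F + 1 := by
  classical
  have hn : 0 < Nat.card F ^ 2 + Nat.card F + 1 := by positivity
  have h : {θ : K | conjNorm F θ = -1} =
      ((Polynomial.nthRoots (Nat.card F ^ 2 + Nat.card F + 1) (-1 : K)).toFinset : Set K) := by
    ext θ
    simp [Polynomial.mem_nthRoots hn, conjNorm_eq_pow]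
  rw [h, Set.ncard_coe_finset]
  exact ⟨Finset.finite_toSet _,
    (Multiset.toFinset_card_le _).trans (Polynomial.card_nthRoots _ _)⟩

variable (F K) in
theorem exists_isPrimitiveRoot_conjNorm :
    ∃ ω : K, IsPrimitiveRoot ω (Nat.card F ^ 2 + Nat.card F + 1) := by
  classical
  have : Finite K := Module.finite_of_finite F
  obtain ⟨g, hg⟩ := IsCyclic.exists_ofOrder_eq_natCard (α := Kˣ)
  have hq : 1 < Nat.card F := Finite.one_lt_card
  have hcard : Nat.card Kˣ = (Nat.card F - 1) * (Nat.card F ^ 2 + Nat.card F + 1) := by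
    let := Fintype.ofFinite K
    rw [Nat.card_eq_fintype_card (α := Kˣ), Fintype.card_units, ← Nat.card_eq_fintype_card, natCard_ext F K]
    obtain ⟨r, hr⟩ := Nat.exists_eq_add_of_lt hq
    rw [hr, show 1 + r + 1 - 1 = r + 1 by omega]
    apply Nat.sub_eq_of_eq_add
    ring
  have h1 := (IsPrimitiveRoot.orderOf g).pow (orderOf_pos g) (hg.trans hcard)
  exact ⟨_, h1.map_of_injective (f := Units.coeHom K) Units.val_injective⟩

/-- The functions `1`, `η`, `ησ(η)` on the elements of norm `1`, together with their conjugates,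
are independent: as powers of `η` they have distinct exponents below `q² + q + 1`. -/
theorem coeff_eq_zero_of_forall_conjNorm_eq_one {c a₀ a₁ a₂ b₀ b₁ b₂ : K}
    (h : ∀ η : K, conjNorm F η = 1 → c + a₀ * η + a₁ * σ η + a₂ * σ (σ η) +
      b₀ * (σ η * σ (σ η)) + b₁ * (η * σ (σ η)) + b₂ * (η * σ η) = 0) :
    a₀ = 0 ∧ b₀ = 0 := by
  classical
  obtain ⟨ω, hω⟩ := exists_isPrimitiveRoot_conjNorm F K
  have hq : 1 < Nat.card F := Finite.one_lt_card
  simp only [conjNorm_eq_pow, frob_apply] at h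
  generalize Nat.card F = q at *
  have hn : 0 < q ^ 2 + q + 1 := by positivity
  let P : Polynomial K := Polynomial.C c + Polynomial.C a₀ * Polynomial.X ^ 1 +
    Polynomial.C a₁ * Polynomial.X ^ q + Polynomial.C a₂ * Polynomial.X ^ (q ^ 2) +
    Polynomial.C b₀ * Polynomial.X ^ (q ^ 2 + q) + Polynomial.C b₁ * Polynomial.X ^ (q ^ 2 + 1) +
    Polynomial.C b₂ * Polynomial.X ^ (q + 1)
  have hdeg : P.natDegree ≤ q ^ 2 + q := by
    have hm : ∀ (e : K) (m : ℕ), m ≤ q ^ 2 + q →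
        (Polynomial.C e * Polynomial.X ^ m).natDegree ≤ q ^ 2 + q := fun e m hm =>
      (Polynomial.natDegree_C_mul_X_pow_le e m).trans hm
    have hqq : q ≤ q ^ 2 := by nlinarith
    refine Polynomial.natDegree_add_le_of_degree_le (Polynomial.natDegree_add_le_of_degree_le
      (Polynomial.natDegree_add_le_of_degree_le (Polynomial.natDegree_add_le_of_degree_le
      (Polynomial.natDegree_add_le_of_degree_le (Polynomial.natDegree_add_le_of_degree_le
      (by simp) (hm _ _ ?_)) (hm _ _ ?_)) (hm _ _ ?_)) (hm _ _ ?_)) (hm _ _ ?_)) (hm _ _ ?_) <;> omega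
  have hP : P = 0 := by
    refine Polynomial.eq_zero_of_natDegree_lt_card_of_eval_eq_zero' P
      (Polynomial.nthRootsFinset (q ^ 2 + q + 1) (1 : K)) ?_ ?_
    · intro η hη
      have := h η ((Polynomial.mem_nthRootsFinset hn 1).1 hη)
      simp only [P, Polynomial.eval_add, Polynomial.eval_mul, Polynomial.eval_C,
        Polynomial.eval_pow, Polynomial.eval_X]
      linear_combination (exp := 1) this
    · rw [hω.card_nthRootsFinset]
      omega
  have hqq : q < q ^ 2 := by nlinarith
  have e1 := congrArg (Polynomial.coeff · 1) hP
  have e2 := congrArg (Polynomial.coeff · (q ^ 2 + q)) hP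
  simp only [P, Polynomial.coeff_add, Polynomial.coeff_C_mul, Polynomial.coeff_X_pow,
    Polynomial.coeff_C, Polynomial.coeff_zero] at e1 e2
  have n1 : 1 ≠ q := by omega
  have n2 : 1 ≠ q ^ 2 := by omega
  have n3 : 1 ≠ q ^ 2 + q := by omega
  have n4 : 1 ≠ q ^ 2 + 1 := by omega
  have n5 : 1 ≠ q + 1 := by omega
  have m1 : q ^ 2 + q ≠ q := by omega
  have m2 : q ^ 2 + q ≠ q ^ 2 := by omega
  have m4 : q ^ 2 + q ≠ q ^ 2 + 1 := by omega
  have m5 : q ^ 2 + q ≠ q + 1 := by omega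
  have m0 : q ^ 2 + q ≠ 0 := by omega
  rw [if_pos trivial, if_neg n1, if_neg n2, if_neg n3, if_neg n4, if_neg n5] at e1
  rw [if_neg m0, if_neg n3.symm, if_neg m1, if_neg m2, if_pos trivial, if_neg m4, if_neg m5] at e2
  constructor
  · simpa using e1
  · simpa using e2

/-- The coordinate change `c ↦ ∑ₗ cₗ σʲ(dₗ)`, `j = 0, 1, 2`, attached to a basis `d` of `K` over
`F`. On `F³` it is `c ↦ (x, σ x, σ² x)` with `x = ∑ₗ cₗ dₗ`. -/
def conjEquiv (d : Module.Basis (Fin 3) F K) : (Fin 3 → K) ≃ₗ[K] (Fin 3 → K) :=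
  LinearEquiv.ofInjectiveEndo
    (Matrix.of ![fun l => d l, fun l => σ (d l), fun l => σ (σ (d l))]).mulVecLin (by
      rw [Matrix.coe_mulVecLin, Matrix.mulVec_injective_iff_isUnit,
        ← Matrix.isUnit_transpose, ← Matrix.mulVec_injective_iff_isUnit]
      rw [← Matrix.coe_mulVecLin, ← LinearMap.ker_eq_bot, LinearMap.ker_eq_bot']
      intro v hv
      have h : ∀ l, v 0 * d l + v 1 * σ (d l) + v 2 * σ (σ (d l)) = 0 := fun l => by
        have := congrFun hv l
        simp at this
        exact (add_assoc _ _ _).trans this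
      let f : K →ₗ[F] K := LinearMap.mulLeft F (v 0) + LinearMap.mulLeft F (v 1) ∘ₗ (frob F K).toLinearMap +
        LinearMap.mulLeft F (v 2) ∘ₗ (frob F K).toLinearMap ∘ₗ (frob F K).toLinearMap
      have hf : f = 0 := d.ext fun l => by simpa [f] using h l
      obtain ⟨h0, h1, h2⟩ := eq_zero_of_forall_linear fun x => by simpa [f] using LinearMap.congr_fun hf x
      ext i
      fin_cases i <;> assumption)

theorem conjEquiv_apply (d : Module.Basis (Fin 3) F K) (c : Fin 3 → K) :
    conjEquiv d c = ![∑ l, c l * d l, ∑ l, c l * σ (d l), ∑ l, c l * σ (σ (d l))] := by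
  ext i
  fin_cases i <;> simp [conjEquiv, Matrix.mulVec, dotProduct, mul_comm]

theorem conjEquiv_algebraMap (d : Module.Basis (Fin 3) F K) (c : Fin 3 → F) :
    conjEquiv d (fun i => algebraMap F K (c i)) =
      ![d.equivFun.symm c, σ (d.equivFun.symm c), σ (σ (d.equivFun.symm c))] := by
  rw [conjEquiv_apply]
  simp [Module.Basis.equivFun_symm_apply, Algebra.smul_def]

/-- Every `F`-linear endomorphism of `K` is a `K`-combination of `1`, `σ`, `σ²`. -/
theorem exists_eq_linear_combination (f : K →ₗ[F] K) :
    ∃ a b c : K, ∀ x, f x = a * x + b * σ x + c * σ (σ x) := by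
  let d : Module.Basis (Fin 3) F K := Module.finBasisOfFinrankEq F K hdeg.out
  let g : (Fin 3 → K) →ₗ[K] (Fin 3 → K) :=
    Matrix.toLin' (Matrix.of fun l => ![d l, σ (d l), σ (σ (d l))])
  have hg : ∀ v l, g v l = v 0 * d l + v 1 * σ (d l) + v 2 * σ (σ (d l)) := fun v l => by
    simp [g, Matrix.mulVec, dotProduct, Fin.sum_univ_three, mul_comm]
  let T (v : Fin 3 → K) : K →ₗ[F] K := LinearMap.mulLeft F (v 0) +
    LinearMap.mulLeft F (v 1) ∘ₗ (frob F K).toLinearMap +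
    LinearMap.mulLeft F (v 2) ∘ₗ (frob F K).toLinearMap ∘ₗ (frob F K).toLinearMap
  have hT : ∀ v x, T v x = v 0 * x + v 1 * σ x + v 2 * σ (σ x) := fun v x => by simp [T]
  have hinj : Function.Injective g := by
    rw [← LinearMap.ker_eq_bot, LinearMap.ker_eq_bot']
    intro v hv
    have h0 : T v = 0 := d.ext fun l => by rw [hT, ← hg, hv]; rfl
    obtain ⟨h0, h1, h2⟩ := eq_zero_of_forall_linear fun x => by rw [← hT, h0]; rfl
    ext i
    fin_cases i <;> assumption
  obtain ⟨v, hv⟩ := (LinearMap.injective_iff_surjective.1 hinj) fun l => f (d l)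
  have h : f = T v := d.ext fun l => by rw [hT, ← hg, hv]
  exact ⟨v 0, v 1, v 2, fun x => by rw [h, hT]⟩

/-- The `F`-trace of `k x`, as an element of `K`. -/
def conjTrace (F : Type*) {K : Type*} [Field F] [Finite F] [Field K] [Algebra F K]
    [Algebra.IsAlgebraic F K] (k x : K) : K :=
  k * x + frob F K k * frob F K x + frob F K (frob F K k) * frob F K (frob F K x)

/-- The determinant that vanishes if and only if `x` and `y` are dependent over `F`. -/
def conjDet (F : Type*) {K : Type*} [Field F] [Finite F] [Field K] [Algebra F K]
    [Algebra.IsAlgebraic F K] (x y : K) : K :=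
  x * frob F K y - y * frob F K x

theorem exists_conjTrace_eq_zero {k : K} (hk : k ≠ 0) :
    ∃ x y : K, conjDet F x y ≠ 0 ∧ conjTrace F k x = 0 ∧ conjTrace F k y = 0 := by
  obtain ⟨v, hv⟩ := exists_frob_ne (F := F) (K := K)
  have hk1 : σ k ≠ 0 := by simpa using hk
  have hk2 : σ (σ k) ≠ 0 := by simpa using hk
  have hv' : σ v - v ≠ 0 := sub_ne_zero.2 hv
  have hv1 : σ (σ v) - σ v ≠ 0 := sub_ne_zero.2 fun e => hv ((frob F K).injective e)
  have hv2 : σ (σ v) - v ≠ 0 := sub_ne_zero.2 fun e => hv (by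
    conv_rhs => rw [← frob_cube F K v, e])
  -- Elements `σ z - z` have trace zero, and the quotient `v + σ v` of these two is not in `F`.
  refine ⟨(σ v - v) / k, (σ v ^ 2 - v ^ 2) / k, ?_, ?_, ?_⟩
  · have : conjDet F ((σ v - v) / k) ((σ v ^ 2 - v ^ 2) / k) =
        (σ v - v) * (σ (σ v) - σ v) * (σ (σ v) - v) / (k * σ k) := by
      simp only [conjDet, map_div₀, map_sub, map_pow]
      field_simp
      ring
    rw [this]
    simp [*]
  · simp only [conjTrace, map_div₀, map_sub, frob_cube]
    field_simp
    ring
  · simp only [conjTrace, map_div₀, map_sub, map_pow, frob_cube]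
    field_simp
    ring

/-- Two independent solutions of `Tr(k x) = 0` span the space of solutions. -/
theorem exists_eq_smul_add_smul {k x₀ x₁ x : K} (hk : k ≠ 0) (hD : conjDet F x₀ x₁ ≠ 0)
    (h₀ : conjTrace F k x₀ = 0) (h₁ : conjTrace F k x₁ = 0) (h : conjTrace F k x = 0) :
    ∃ s t : F, x = s • x₀ + t • x₁ := by
  have hk2 : σ (σ k) ≠ 0 := by simpa using hk
  -- The cross products of two solutions are proportional to `(k, σ k, σ² k)`.
  have key : ∀ {y z : K}, conjTrace F k y = 0 → conjTrace F k z = 0 →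
      σ (σ k) * σ (conjDet F y z) = k * conjDet F y z := fun {y z} hy hz => by
    simp only [conjTrace, conjDet, map_sub, map_mul] at *
    linear_combination σ y * hz - σ z * hy
  have hD1 : σ (conjDet F x₀ x₁) ≠ 0 := by simpa using hD
  have fix : ∀ {y z : K}, conjTrace F k y = 0 → conjTrace F k z = 0 →
      σ (conjDet F y z / conjDet F x₀ x₁) = conjDet F y z / conjDet F x₀ x₁ :=
    fun {y z} hy hz => by
      rw [map_div₀, div_eq_div_iff hD1 hD]
      apply mul_left_cancel₀ hk2
      linear_combination conjDet F x₀ x₁ * key hy hz - conjDet F y z * key h₀ h₁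
  obtain ⟨s, hs⟩ := exists_algebraMap_eq (fix h h₁)
  obtain ⟨t, ht⟩ := exists_algebraMap_eq (fix h₀ h)
  refine ⟨s, t, ?_⟩
  rw [Algebra.smul_def, Algebra.smul_def, hs, ht]
  field_simp
  simp only [conjDet]
  ring

theorem conjTrace_smul_add_smul {k x₀ x₁ : K}
    (h₀ : conjTrace F k x₀ = 0) (h₁ : conjTrace F k x₁ = 0) (s t : F) :
    conjTrace F k (s • x₀ + t • x₁) = 0 := by
  simp only [conjTrace, Algebra.smul_def, map_add, map_mul, AlgEquiv.commutes] at *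
  linear_combination algebraMap F K s * h₀ + algebraMap F K t * h₁

theorem eq_zero_of_smul_add_smul_eq_zero {x₀ x₁ : K} (hD : conjDet F x₀ x₁ ≠ 0) {s t : F}
    (h : s • x₀ + t • x₁ = 0) : s = 0 ∧ t = 0 := by
  have h' := congrArg (frob F K) h
  simp only [Algebra.smul_def, map_add, map_mul, AlgEquiv.commutes, map_zero] at h h'
  have hs : algebraMap F K s * conjDet F x₀ x₁ = 0 := by
    simp only [conjDet]; linear_combination σ x₁ * h - x₁ * h'
  have ht : algebraMap F K t * conjDet F x₀ x₁ = 0 := by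
    simp only [conjDet]; linear_combination x₀ * h' - σ x₀ * h
  simpa [hD] using And.intro hs ht

/-! ### Coordinates adapted to an exterior subplane -/

variable (F) in
/-- The vector `(x, σ x, σ² x)`. -/
def frobVec (x : K) : Vec3 K := ![x, σ x, σ (σ x)]

theorem frobVec_zero : frobVec F (0 : K) = 0 := by
  ext i; fin_cases i <;> simp [frobVec]

theorem frobVec_ne_zero {x : K} (hx : x ≠ 0) : frobVec F x ≠ 0 := fun h => hx (congrFun h 0)

variable (F) in
/-- A coordinate system of `PG(2,K)` adapted to an exterior subplane `π`: the points of `π` are the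
`H (x, σ x, σ² x)`, and the line at infinity is `X₀ = 0`. -/
structure IsFrame (H : Vec3 K ≃ₗ[K] Vec3 K) (π : Set (ℙ K (Vec3 K))) : Prop where
  apply_two : ∀ X, H X 2 = X 0
  mem_iff : ∀ P, P ∈ π ↔ ∃ (x : K) (hx : H (frobVec F x) ≠ 0), P = Projectivization.mk K _ hx

theorem mk_onSubspace_iff {k V : Type*} [Field k] [AddCommGroup V] [Module k V] {v : V}
    (hv : v ≠ 0) (W : Submodule k V) : OnSubspace (Projectivization.mk k v hv) W ↔ v ∈ W := by
  rw [OnSubspace, Projectivization.submodule_mk, Submodule.span_singleton_le_iff_mem]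

theorem mem_lineAtInfinity {v : Vec3 K} : v ∈ lineAtInfinity K ↔ v 2 = 0 := Iff.rfl

/-- The third coordinate of `h` is an `F`-isomorphism of `F³` with `K`, since `π` is exterior; this
identifies `π` with `K` up to `F`-scalars. -/
theorem exists_isFrame {h : Vec3 K ≃ₗ[K] Vec3 K} {π : Set (ℙ K (Vec3 K))}
    (hπ : Coordinatises F h π) (hext : IsExteriorTo π (lineAtInfinity K)) :
    ∃ d : Module.Basis (Fin 3) F K, IsFrame F ((conjEquiv d).symm.trans h) π := by
  let emb : Vec3 F →ₗ[F] Vec3 K := (Algebra.linearMap F K).compLeft (Fin 3)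
  have hemb : ∀ x : Vec3 F, emb x = fun i => algebraMap F K (x i) := fun x => rfl
  let L : Vec3 F →ₗ[F] K :=
    (LinearMap.proj (R := F) (φ := fun _ : Fin 3 => K) 2) ∘ₗ (h.toLinearMap.restrictScalars F) ∘ₗ emb
  have hL : ∀ x, L x = h (fun i => algebraMap F K (x i)) 2 := fun x => rfl
  have hLinj : Function.Injective L := by
    rw [← LinearMap.ker_eq_bot, LinearMap.ker_eq_bot']
    intro x hx
    by_contra hx0
    have hx' : (fun i => algebraMap F K (x i)) ≠ (0 : Vec3 K) := fun h0 => hx0 (by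
      ext i
      simpa using congrFun h0 i)
    refine hext (homography h (Projectivization.mk K _ hx')) ?_ ?_
    · rw [hπ]
      exact ⟨_, ⟨x, hx', rfl⟩, rfl⟩
    · rw [homography, Projectivization.map_mk, mk_onSubspace_iff]
      exact hx
  let e : Vec3 F ≃ₗ[F] K := LinearEquiv.ofInjectiveOfFinrankEq L hLinj (by simp [hdeg.out])
  have he : ∀ x, e x = L x := fun x => rfl
  let d : Module.Basis (Fin 3) F K := Module.Basis.ofEquivFun e.symm
  have hd : ∀ c, d.equivFun.symm c = L c := fun c => by simp [d, he]
  have hdl : ∀ l, h (Pi.single l 1) 2 = d l := fun l => by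
    rw [Module.Basis.coe_ofEquivFun]
    simp only [LinearEquiv.symm_symm, he, hL]
    have : (Pi.single l 1 : Vec3 K) = fun i => algebraMap F K ((Pi.single l 1 : Vec3 F) i) := by
      funext i
      rw [Pi.single_apply, Pi.single_apply]
      split_ifs <;> simp
    rw [this]
  refine ⟨d, fun X => ?_, fun P => ?_⟩
  · obtain ⟨c, rfl⟩ := (conjEquiv d).surjective X
    have hc : c = ∑ l, c l • (Pi.single l (1 : K) : Vec3 K) := by
      funext i
      simp [Finset.sum_apply, Pi.single_apply]
    rw [LinearEquiv.trans_apply, LinearEquiv.symm_apply_apply, conjEquiv_apply]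
    conv_lhs => rw [hc]
    simp [map_sum, hdl]
  · have key : ∀ c : Vec3 F, ((conjEquiv d).symm.trans h) (frobVec F (L c)) =
        h (fun i => algebraMap F K (c i)) := fun c => by
      rw [LinearEquiv.trans_apply, frobVec, ← hd, ← conjEquiv_algebraMap,
        LinearEquiv.symm_apply_apply]
    rw [hπ]
    constructor
    · rintro ⟨_, ⟨c, hc, rfl⟩, rfl⟩
      refine ⟨L c, ?_, ?_⟩
      · rw [key]
        simpa using hc
      · simp only [homography, Projectivization.map_mk, key]
        rfl
    · rintro ⟨x, hx, rfl⟩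
      obtain ⟨c, rfl⟩ := e.surjective x
      have hc : (fun i => algebraMap F K (c i)) ≠ (0 : Vec3 K) := fun h0 => hx (by
        rw [he, key, h0, map_zero])
      refine ⟨_, ⟨c, hc, rfl⟩, ?_⟩
      simp only [homography, Projectivization.map_mk, he, key]
      rfl

variable (F K) in
/-- An `F`-linear retraction of `K` onto `F`. -/
def toBase : K →ₗ[F] F :=
  Classical.choose ((Algebra.linearMap F K).exists_leftInverse_of_injective
    (LinearMap.ker_eq_bot.2 (algebraMap F K).injective))

theorem toBase_algebraMap (c : F) : toBase F K (algebraMap F K c) = c :=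
  LinearMap.congr_fun (Classical.choose_spec ((Algebra.linearMap F K).exists_leftInverse_of_injective
    (LinearMap.ker_eq_bot.2 (algebraMap F K).injective))) c

/-- The Bruck–Bose map in adapted coordinates: it sends `X` to the vector of `PG(6,F)` that
represents `H X`. Only the values at those `X` with `X₀ ∈ F` matter. -/
def ofFrame (b : Module.Basis (Fin 3) F K) (H : Vec3 K ≃ₗ[K] Vec3 K) : Vec3 K →ₗ[F] Vec7 F where
  toFun X := (b.equivFun (H X 0), b.equivFun (H X 1), toBase F K (X 0))
  map_add' X Y := by simp
  map_smul' c X := by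
    have : H (c • X) = c • H X := (H.toLinearMap.restrictScalars F).map_smul c X
    simp [this]

/-- The inverse of `ofFrame`. -/
def toFrame (b : Module.Basis (Fin 3) F K) (H : Vec3 K ≃ₗ[K] Vec3 K) : Vec7 F →ₗ[F] Vec3 K where
  toFun w := H.symm ![b.equivFun.symm w.1, b.equivFun.symm w.2.1, algebraMap F K w.2.2]
  map_add' v w := by
    rw [← map_add]
    congr 1
    ext i; fin_cases i <;> simp [-Module.Basis.equivFun_symm_apply]
  map_smul' c w := by
    have : ∀ v : Vec3 K, H.symm (c • v) = c • H.symm v := fun v =>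
      (H.symm.toLinearMap.restrictScalars F).map_smul c v
    rw [RingHom.id_apply, ← this]
    congr 1
    ext i
    fin_cases i
    · exact map_smul b.equivFun.symm c w.1
    · exact map_smul b.equivFun.symm c w.2.1
    · simp [Algebra.smul_def]

variable {b : Module.Basis (Fin 3) F K} {H : Vec3 K ≃ₗ[K] Vec3 K} {π : Set (ℙ K (Vec3 K))}

theorem ofFrame_apply (X : Vec3 K) :
    ofFrame b H X = (b.equivFun (H X 0), b.equivFun (H X 1), toBase F K (X 0)) := rfl

theorem apply_toFrame (w : Vec7 F) : H (toFrame b H w) =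
    ![b.equivFun.symm w.1, b.equivFun.symm w.2.1, algebraMap F K w.2.2] :=
  H.apply_symm_apply _

theorem IsFrame.toFrame_zero (hH : IsFrame F H π) (w : Vec7 F) :
    toFrame b H w 0 = algebraMap F K w.2.2 := by
  rw [← hH.apply_two (toFrame b H w), apply_toFrame]; rfl

theorem IsFrame.toFrame_ofFrame (hH : IsFrame F H π) {X : Vec3 K} {c : F}
    (hX : X 0 = algebraMap F K c) : toFrame b H (ofFrame b H X) = X := by
  apply H.injective
  rw [apply_toFrame, ofFrame_apply]
  ext i
  fin_cases i
  · simp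
  · simp
  · simp [hX, toBase_algebraMap, hH.apply_two]

theorem IsFrame.toFrame_ofFrame_zero (hH : IsFrame F H π) (β γ : K) :
    toFrame b H (ofFrame b H ![0, β, γ]) = ![0, β, γ] :=
  hH.toFrame_ofFrame (c := 0) (by simp)

theorem IsFrame.ofFrame_toFrame (hH : IsFrame F H π) (w : Vec7 F) :
    ofFrame b H (toFrame b H w) = w := by
  rw [ofFrame_apply, apply_toFrame, hH.toFrame_zero, toBase_algebraMap]
  simp [-Module.Basis.equivFun_symm_apply, -Module.Basis.equivFun_apply]

theorem IsFrame.toFrame_injective (hH : IsFrame F H π) : Function.Injective (toFrame b H) :=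
  Function.LeftInverse.injective hH.ofFrame_toFrame

theorem mem_sigmaInfinity {k : Type*} [Field k] {w : Vec7 k} :
    w ∈ sigmaInfinity k ↔ w.2.2 = 0 := Iff.rfl

theorem IsFrame.mem_sigmaInfinity_iff (hH : IsFrame F H π) {w : Vec7 F} :
    w ∈ sigmaInfinity F ↔ toFrame b H w 0 = 0 := by
  rw [mem_sigmaInfinity, hH.toFrame_zero, map_eq_zero]

/-- The plane `{(0, β, f β)}` of the hyperplane at infinity, in adapted coordinates. -/
def graphPlane (b : Module.Basis (Fin 3) F K) (H : Vec3 K ≃ₗ[K] Vec3 K) (f : K →ₗ[F] K) :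
    Submodule F (Vec7 F) where
  carrier := {w | toFrame b H w 0 = 0 ∧ toFrame b H w 2 = f (toFrame b H w 1)}
  add_mem' := by
    rintro v w ⟨h1, h2⟩ ⟨h3, h4⟩
    simp [h1, h2, h3, h4]
  zero_mem' := by simp
  smul_mem' := by
    rintro c w ⟨h1, h2⟩
    simp [h1, h2]

theorem mem_graphPlane {f : K →ₗ[F] K} {w : Vec7 F} : w ∈ graphPlane b H f ↔
    toFrame b H w 0 = 0 ∧ toFrame b H w 2 = f (toFrame b H w 1) := Iff.rfl

theorem IsFrame.ofFrame_mem_graphPlane (hH : IsFrame F H π) {f : K →ₗ[F] K} {β γ : K} :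
    ofFrame b H ![0, β, γ] ∈ graphPlane b H f ↔ γ = f β := by
  rw [mem_graphPlane, hH.toFrame_ofFrame_zero]
  simp

/-- The map `x ↦ θ τ(x)`. -/
def twist (θ : K) (τ : K ≃ₐ[F] K) : K →ₗ[F] K := LinearMap.mulLeft F θ ∘ₗ τ.toLinearMap

@[simp] theorem twist_apply (θ : K) (τ : K ≃ₐ[F] K) (x : K) : twist θ τ x = θ * τ x := rfl

/-- The planes `γ = θ τ(β)` with `θ` of norm `-1`. For `τ = 1` this is the exterior splash, and for
`τ = σ` and `τ = σ²` these are its two covers. -/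
def twistPlanes (b : Module.Basis (Fin 3) F K) (H : Vec3 K ≃ₗ[K] Vec3 K) (τ : K ≃ₐ[F] K) :
    Set (Submodule F (Vec7 F)) :=
  (fun θ => graphPlane b H (twist θ τ)) '' {θ | conjNorm F θ = -1}

/-! ### The exterior splash -/

/-- The extended line of `π` with equation `Tr(k x) = 0`. -/
def lineOf (F : Type*) {K : Type*} [Field F] [Finite F] [Field K] [Algebra F K]
    [Algebra.IsAlgebraic F K] (H : Vec3 K ≃ₗ[K] Vec3 K) (k : K) : Submodule K (Vec3 K) :=
  LinearMap.ker ((k • LinearMap.proj (R := K) (φ := fun _ : Fin 3 => K) 0 +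
    frob F K k • LinearMap.proj (R := K) (φ := fun _ : Fin 3 => K) 1 +
    frob F K (frob F K k) • LinearMap.proj (R := K) (φ := fun _ : Fin 3 => K) 2) ∘ₗ
      H.symm.toLinearMap)

theorem apply_mem_lineOf {k : K} {X : Vec3 K} :
    H X ∈ lineOf F H k ↔ k * X 0 + σ k * X 1 + σ (σ k) * X 2 = 0 := by
  simp [lineOf]

theorem apply_frobVec_mem_lineOf {k x : K} :
    H (frobVec F x) ∈ lineOf F H k ↔ conjTrace F k x = 0 := apply_mem_lineOf

theorem finrank_lineOf {k : K} (hk : k ≠ 0) : Module.finrank K (lineOf F H k) = 2 := by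
  have h := LinearMap.finrank_range_add_finrank_ker
    ((k • LinearMap.proj (R := K) (φ := fun _ : Fin 3 => K) 0 +
    frob F K k • LinearMap.proj (R := K) (φ := fun _ : Fin 3 => K) 1 +
    frob F K (frob F K k) • LinearMap.proj (R := K) (φ := fun _ : Fin 3 => K) 2) ∘ₗ
      H.symm.toLinearMap)
  rw [LinearMap.range_eq_top.2, finrank_top] at h
  · simp only [Module.finrank_self, Module.finrank_fin_fun] at h
    rw [lineOf]
    omega
  · intro c
    refine ⟨H ![c / k, 0, 0], ?_⟩
    simp [mul_div_cancel₀ _ hk]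

theorem mk_frobVec_ne {x y : K} (hD : conjDet F x y ≠ 0) (hx : H (frobVec F x) ≠ 0)
    (hy : H (frobVec F y) ≠ 0) :
    Projectivization.mk K _ hx ≠ Projectivization.mk K _ hy := by
  intro h
  obtain ⟨a, ha⟩ := (Projectivization.mk_eq_mk_iff' K _ _ hx hy).1 h
  rw [← map_smul] at ha
  have ha' := H.injective ha
  have h0 : a * y = x := congrFun ha' 0
  have h1 : a * σ y = σ x := congrFun ha' 1
  apply hD
  rw [conjDet]
  linear_combination y * h1 - σ y * h0

theorem apply_frobVec_ne_zero {x : K} (hx : x ≠ 0) : H (frobVec F x) ≠ 0 := by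
  simpa using frobVec_ne_zero hx

theorem IsFrame.isExtendedLine_lineOf (hH : IsFrame F H π) {k : K} (hk : k ≠ 0) :
    IsExtendedLine π (lineOf F H k) := by
  obtain ⟨x, y, hD, hx, hy⟩ := exists_conjTrace_eq_zero (F := F) hk
  have hx0 : x ≠ 0 := by rintro rfl; simp [conjDet] at hD
  have hy0 : y ≠ 0 := by rintro rfl; simp [conjDet] at hD
  refine ⟨finrank_lineOf hk, _, (hH.mem_iff _).2 ⟨x, apply_frobVec_ne_zero hx0, rfl⟩, _,
    (hH.mem_iff _).2 ⟨y, apply_frobVec_ne_zero hy0, rfl⟩, mk_frobVec_ne hD _ _, ?_, ?_⟩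
  · rwa [mk_onSubspace_iff, apply_frobVec_mem_lineOf]
  · rwa [mk_onSubspace_iff, apply_frobVec_mem_lineOf]

theorem IsFrame.mem_spreadPlane (hH : IsFrame F H π) {β γ : K} (hv : H ![0, β, γ] ≠ 0)
    {w : Vec7 F} : w ∈ spreadPlane b (Projectivization.mk K _ hv) ↔
      ∃ c : K, toFrame b H w = ![0, c * β, c * γ] := by
  have key : ∀ c : K, ofFrame b H ![0, c * β, c * γ] = toInfinity b (c • H ![0, β, γ]) := by
    intro c
    have : (![0, c * β, c * γ] : Vec3 K) = c • ![0, β, γ] := by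
      ext i; fin_cases i <;> simp
    rw [← map_smul, ← this, ofFrame_apply]
    simp [toInfinity]
  simp only [spreadPlane, Projectivization.submodule_mk, Submodule.mem_map,
    Submodule.restrictScalars_mem, Submodule.mem_span_singleton]
  constructor
  · rintro ⟨_, ⟨c, rfl⟩, rfl⟩
    exact ⟨c, by rw [← key, hH.toFrame_ofFrame_zero]⟩
  · rintro ⟨c, hc⟩
    exact ⟨_, ⟨c, rfl⟩, by rw [← key, ← hc, hH.ofFrame_toFrame]⟩

theorem IsFrame.spreadPlane_eq_graphPlane (hH : IsFrame F H π) {β θ : K} (hβ : β ≠ 0)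
    (hv : H ![0, β, θ * β] ≠ 0) :
    spreadPlane b (Projectivization.mk K _ hv) = graphPlane b H (twist θ 1) := by
  ext w
  rw [hH.mem_spreadPlane, mem_graphPlane]
  constructor
  · rintro ⟨c, hc⟩
    rw [hc]
    simp
    ring
  · rintro ⟨h0, h2⟩
    refine ⟨toFrame b H w 1 / β, ?_⟩
    ext i
    fin_cases i
    · simpa using h0
    · simp [hβ]
    · simp only [twist_apply, AlgEquiv.one_apply] at h2
      simp [h2]
      field_simp

/-- Hilbert's theorem 90 for `σ²`. The element `θ σ²(θ)` has norm `1`, and `σ(z) = θ σ²(θ) z` implies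
`σ²(z) = θ² σ(θ) σ²(θ) z = -θ z`. -/
theorem exists_conj_eq_neg_mul {θ : K} (hθ : conjNorm F θ = -1) :
    ∃ w : K, w ≠ 0 ∧ σ (σ w) = -(θ * w) := by
  have h1 : conjNorm F (θ * σ (σ θ)) = 1 := by
    rw [conjNorm_mul, conjNorm_frob, conjNorm_frob, hθ]
    ring
  obtain ⟨z, hz, hz1⟩ := exists_frob_eq_mul h1
  refine ⟨z, hz, ?_⟩
  have hz2 := congrArg (frob F K) hz1
  simp only [map_mul, frob_cube] at hz2
  rw [hz2, hz1]
  simp only [conjNorm] at hθ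
  linear_combination (θ * z) * hθ

/-- The exterior splash consists of the planes `γ = θ β` with `θ` of norm `-1`. The extended line
of `π` through the points with parameters `x` and `y` meets the line at infinity in `(0, w, -σ² w)`,
where `w = x σ(y) - y σ(x)`. -/
theorem IsFrame.splashPlanes_eq (hH : IsFrame F H π) : splashPlanes b π = twistPlanes b H 1 := by
  ext α
  constructor
  · rintro ⟨T, ⟨hT, m, ⟨hm2, P, hP, Q, hQ, hPQ, hPm, hQm⟩, hTm⟩, rfl⟩
    obtain ⟨x, hx, rfl⟩ := (hH.mem_iff _).1 hP
    obtain ⟨y, hy, rfl⟩ := (hH.mem_iff _).1 hQ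
    rw [mk_onSubspace_iff] at hPm hQm
    have hli : LinearIndependent K ![H (frobVec F x), H (frobVec F y)] := by
      rw [LinearIndependent.pair_iff' hx]
      intro a ha
      exact hPQ ((Projectivization.mk_eq_mk_iff' K _ _ hx hy).2 ⟨a⁻¹, by
        have ha0 : a ≠ 0 := by
          rintro rfl
          exact hy (by rw [← ha, zero_smul])
        rw [← ha, smul_smul, inv_mul_cancel₀ ha0, one_smul]⟩)
    have hspan : m = Submodule.span K {H (frobVec F x), H (frobVec F y)} := by
      symm
      apply Submodule.eq_of_le_of_finrank_eq
      · rw [Submodule.span_le]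
        rintro v (rfl | rfl)
        · exact hPm
        · exact hQm
      · have := finrank_span_eq_card hli
        rw [Matrix.range_cons_cons_empty] at this
        rw [hm2]
        simpa using this
    have hT0 := T.rep_nonzero
    rw [← T.mk_rep, mk_onSubspace_iff] at hT hTm
    rw [hspan, Submodule.mem_span_pair] at hTm
    obtain ⟨l, n, hln⟩ := hTm
    rw [← map_smul, ← map_smul, ← map_add] at hln
    have h0 : l * x + n * y = 0 := by
      rw [← hln, mem_lineAtInfinity, hH.apply_two] at hT
      simpa [frobVec] using hT
    have hx0 : x ≠ 0 := by
      rintro rfl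
      apply hx
      rw [frobVec_zero, map_zero]
    have hX : l • frobVec F x + n • frobVec F y =
        ![0, n / x * conjDet F x y, n / x * -σ (σ (conjDet F x y))] := by
      ext i
      fin_cases i
      · simpa [frobVec] using h0
      · simp only [frobVec, conjDet, Fin.mk_one, Pi.add_apply, Pi.smul_apply, smul_eq_mul,
          Matrix.cons_val_one, Matrix.cons_val_zero]
        field_simp
        linear_combination σ x * h0
      · simp only [frobVec, conjDet, Fin.reduceFinMk, Pi.add_apply, Pi.smul_apply, smul_eq_mul,
          Matrix.cons_val, map_sub, map_mul, frob_cube]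
        field_simp
        linear_combination σ (σ x) * h0
    have hw : n / x * conjDet F x y ≠ 0 := by
      intro h
      apply hT0
      rw [← hln, hX, h]
      rcases mul_eq_zero.1 h with h' | h' <;> simp [h']
    have hw' : conjDet F x y ≠ 0 := right_ne_zero_of_mul hw
    set w := conjDet F x y with hwdef
    refine ⟨-σ (σ w) / w, ?_, ?_⟩
    · have h1 : σ w ≠ 0 := by simpa using hw'
      have h2 : σ (σ w) ≠ 0 := by simpa using hw'
      simp only [Set.mem_ofPred_eq, conjNorm, map_div₀, map_neg, frob_cube]
      field_simp
    · have hX' : l • frobVec F x + n • frobVec F y =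
          ![0, n / x * w, (-σ (σ w) / w) * (n / x * w)] := by
        rw [hX]
        congr 3
        field_simp
      have hv : H ![0, n / x * w, (-σ (σ w) / w) * (n / x * w)] ≠ 0 := by
        rwa [← hX', hln]
      have hTeq : T = Projectivization.mk K _ hv := by
        rw [← T.mk_rep]
        congr 1
        rw [← hX', hln]
      simp only
      rw [hTeq, hH.spreadPlane_eq_graphPlane hw]
  · rintro ⟨θ, hθ, rfl⟩
    obtain ⟨w, hw, hw2⟩ := exists_conj_eq_neg_mul hθ
    have hv : H ![0, w, θ * w] ≠ 0 := by
      simp [hw]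
    -- `(0, w, -σ² w)` lies on the line with coefficients `σ w, σ² w, w`.
    refine ⟨Projectivization.mk K _ hv, ⟨?_, lineOf F H (σ w),
      hH.isExtendedLine_lineOf (by simpa using hw), ?_⟩, hH.spreadPlane_eq_graphPlane hw hv⟩
    · rw [mk_onSubspace_iff, mem_lineAtInfinity, hH.apply_two]
      rfl
    · rw [mk_onSubspace_iff, apply_mem_lineOf]
      simp only [frob_cube, Matrix.cons_val]
      linear_combination w * hw2

/-! ### Affine points -/

/-- The Bruck–Bose image of the point of `π` with parameter `x`. -/
def affineVec (b : Module.Basis (Fin 3) F K) (H : Vec3 K ≃ₗ[K] Vec3 K) (x : K) : Vec7 F :=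
  ofFrame b H ![1, σ x / x, σ (σ x) / x]

theorem affineVec_ne_zero (x : K) : affineVec b H x ≠ 0 := fun h => by
  have h1 : toBase F K 1 = 0 := congrArg (fun w => w.2.2) h
  rw [← map_one (algebraMap F K), toBase_algebraMap] at h1
  exact one_ne_zero h1

theorem IsFrame.mem_bruckBose_iff (hH : IsFrame F H π) {Y : Set (ℙ K (Vec3 K))} (hY : Y ⊆ π)
    {R : ℙ F (Vec7 F)} : R ∈ bruckBose b Y ↔ ∃ (x : K) (hx : x ≠ 0),
      Projectivization.mk K _ (apply_frobVec_ne_zero (F := F) (H := H) hx) ∈ Y ∧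
        R = Projectivization.mk F _ (affineVec_ne_zero (b := b) (H := H) x) := by
  have key : ∀ x : K, x ≠ 0 → H ![1, σ x / x, σ (σ x) / x] = x⁻¹ • H (frobVec F x) := by
    intro x hx
    rw [← map_smul]
    congr 1
    ext i
    fin_cases i <;> simp [frobVec, hx, div_eq_inv_mul]
  have htwo : ∀ x : K, H ![1, σ x / x, σ (σ x) / x] 2 = 1 := fun x => hH.apply_two _
  have haff : ∀ x, affineVec b H x = (b.equivFun (H ![1, σ x / x, σ (σ x) / x] 0),
      b.equivFun (H ![1, σ x / x, σ (σ x) / x] 1), 1) := fun x => by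
    rw [affineVec, ofFrame_apply]
    have : toBase F K 1 = 1 := by rw [← map_one (algebraMap F K), toBase_algebraMap]
    simp [this]
  constructor
  · rintro ⟨α, β, hP, hR, hmem, rfl⟩
    obtain ⟨x, hx, hxe⟩ := (hH.mem_iff _).1 (hY hmem)
    have hx0 : x ≠ 0 := by
      rintro rfl
      apply hx
      rw [frobVec_zero, map_zero]
    refine ⟨x, hx0, hxe ▸ hmem, ?_⟩
    obtain ⟨a, ha⟩ := (Projectivization.mk_eq_mk_iff' K _ _ hP hx).1 hxe
    have ha2 : a * x = 1 := by
      have := congrFun ha 2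
      simpa [hH.apply_two, frobVec] using this
    have ha3 : a = x⁻¹ := eq_inv_of_mul_eq_one_left ha2
    rw [ha3, ← key x hx0] at ha
    congr 1
    rw [haff, ha]
    rfl
  · rintro ⟨x, hx, hmem, rfl⟩
    have hv : (![H ![1, σ x / x, σ (σ x) / x] 0, H ![1, σ x / x, σ (σ x) / x] 1, 1] : Vec3 K) =
        x⁻¹ • H (frobVec F x) := by
      rw [← key x hx]
      ext i
      fin_cases i
      · rfl
      · rfl
      · exact (htwo x).symm
    have hv0 : (![H ![1, σ x / x, σ (σ x) / x] 0, H ![1, σ x / x, σ (σ x) / x] 1, 1] : Vec3 K) ≠ 0 :=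
      fun h => one_ne_zero (congrFun h 2)
    refine ⟨_, _, hv0, haff x ▸ affineVec_ne_zero x, ?_, ?_⟩
    · convert hmem using 1
      exact (Projectivization.mk_eq_mk_iff' K _ _ _ _).2 ⟨x⁻¹, hv.symm⟩
    · congr 1
      exact haff x

/-! ### The two covers of the exterior splash -/

/-- If `a x + b σ(x) + c σ²(x) = θ x` has a nonzero solution for each `θ` of norm `-1`, then
`a = 0` and `b` or `c` vanishes: the Dickson determinant of `a - θ, b, c` is a combination of the
functions of `coeff_eq_zero_of_forall_conjNorm_eq_one`. -/
theorem eq_zero_of_forall_exists_eigenvector {a b c : K}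
    (h : ∀ θ : K, conjNorm F θ = -1 → ∃ x : K, x ≠ 0 ∧ a * x + b * σ x + c * σ (σ x) = θ * x) :
    a = 0 ∧ (b = 0 ∨ c = 0) := by
  have key : ∀ η : K, conjNorm F η = 1 →
      (a * σ a * σ (σ a) + 1 + b * σ b * σ (σ b) + c * σ c * σ (σ c) - a * σ b * σ (σ c) -
        σ a * σ (σ b) * c - σ (σ a) * b * σ c) +
      (σ a * σ (σ a) - σ b * σ (σ c)) * η + (a * σ (σ a) - σ (σ b) * c) * σ η +
      (a * σ a - b * σ c) * σ (σ η) + a * (σ η * σ (σ η)) + σ a * (η * σ (σ η)) +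
      σ (σ a) * (η * σ η) = 0 := by
    intro η hη
    obtain ⟨x, hx, e₀⟩ := h (-η) (by rw [conjNorm_neg, hη])
    have e₁ := congrArg (frob F K) e₀
    have e₂ := congrArg (frob F K) e₁
    simp only [map_add, map_mul, map_neg, frob_cube] at e₁ e₂
    apply mul_right_cancel₀ hx
    simp only [conjNorm] at hη
    linear_combination ((σ a + σ η) * (σ (σ a) + σ (σ η)) - σ b * σ (σ c)) * e₀ -
      (b * (σ (σ a) + σ (σ η)) - c * σ (σ c)) * e₁ + (b * σ b - c * (σ a + σ η)) * e₂ - x * hη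
  obtain ⟨h1, rfl⟩ := coeff_eq_zero_of_forall_conjNorm_eq_one key
  refine ⟨rfl, ?_⟩
  simpa using h1

/-- A plane that could belong to a cover is the graph of `θ σ` or of `θ σ²`. -/
theorem IsFrame.eq_graphPlane (hH : IsFrame F H π) {α : Submodule F (Vec7 F)}
    (h3 : Module.finrank F α = 3)
    (hα : ∀ v ∈ α, ∃ S ∈ splashPlanes b π, v ∈ S)
    (h1 : ∀ S ∈ splashPlanes b π, Module.finrank F (α ⊓ S : Submodule F (Vec7 F)) = 1) :
    ∃ θ : K, conjNorm F θ = -1 ∧ (α = graphPlane b H (twist θ (frob F K)) ∨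
      α = graphPlane b H (twist θ ((frob F K).trans (frob F K)))) := by
  rw [hH.splashPlanes_eq] at hα h1
  have hmem : ∀ v ∈ α, toFrame b H v 0 = 0 ∧
      conjNorm F (toFrame b H v 2) = -conjNorm F (toFrame b H v 1) := by
    intro v hv
    obtain ⟨_, ⟨θ, hθ, rfl⟩, hvθ⟩ := hα v hv
    obtain ⟨h0, h2⟩ := mem_graphPlane.1 hvθ
    refine ⟨h0, ?_⟩
    have hθ' : conjNorm F θ = -1 := hθ
    rw [h2, twist_apply, AlgEquiv.one_apply, conjNorm_mul, hθ']
    ring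
  let p (i : Fin 3) : α →ₗ[F] K := LinearMap.proj (R := F) (φ := fun _ : Fin 3 => K) i ∘ₗ
    toFrame b H ∘ₗ α.subtype
  have hp : ∀ i v, p i v = toFrame b H v i := fun _ _ => rfl
  have hinj : Function.Injective (p 1) := by
    rw [← LinearMap.ker_eq_bot, LinearMap.ker_eq_bot']
    rintro ⟨v, hv⟩ hv1
    obtain ⟨h0, h2⟩ := hmem v hv
    have hv1' : toFrame b H v 1 = 0 := hv1
    rw [hv1', conjNorm_eq_zero.2 rfl, neg_zero, conjNorm_eq_zero] at h2
    apply Subtype.ext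
    apply hH.toFrame_injective
    rw [Submodule.coe_zero, map_zero]
    ext i
    fin_cases i <;> assumption
  let e : α ≃ₗ[F] K := LinearEquiv.ofInjectiveOfFinrankEq (p 1) hinj (by rw [h3, hdeg.out])
  have he : ∀ v, e v = toFrame b H v 1 := fun v => rfl
  let f : K →ₗ[F] K := p 2 ∘ₗ e.symm.toLinearMap
  have hf : ∀ x, f x = toFrame b H (e.symm x) 2 := fun x => rfl
  have hαf : α = graphPlane b H f := by
    ext w
    rw [mem_graphPlane]
    constructor
    · intro hw
      refine ⟨(hmem w hw).1, ?_⟩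
      have : toFrame b H w 1 = e ⟨w, hw⟩ := rfl
      rw [this, hf, e.symm_apply_apply]
    · rintro ⟨h0, h2⟩
      have : w = e.symm (toFrame b H w 1) := by
        apply hH.toFrame_injective
        ext i
        fin_cases i
        · exact h0.trans (hmem _ (e.symm (toFrame b H w 1)).2).1.symm
        · exact (e.apply_symm_apply (toFrame b H w 1)).symm
        · exact h2
      rw [this]
      exact (e.symm (toFrame b H w 1)).2
  obtain ⟨a, u, v, hauv⟩ := exists_eq_linear_combination f
  have heig : ∀ θ : K, conjNorm F θ = -1 →
      ∃ x : K, x ≠ 0 ∧ a * x + u * σ x + v * σ (σ x) = θ * x := by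
    intro θ hθ
    have hne : α ⊓ graphPlane b H (twist θ 1) ≠ ⊥ := fun h0 => by
      have := h1 _ ⟨θ, hθ, rfl⟩
      simp only at this
      rw [h0, finrank_bot] at this
      exact zero_ne_one this
    obtain ⟨w, ⟨hw1, hw2⟩, hw0⟩ := (Submodule.ne_bot_iff _).1 hne
    rw [SetLike.mem_coe, hαf] at hw1
    obtain ⟨h0, h2⟩ := mem_graphPlane.1 hw1
    obtain ⟨-, h2'⟩ := mem_graphPlane.1 hw2
    refine ⟨toFrame b H w 1, ?_, ?_⟩
    · intro hw1
      apply hw0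
      apply hH.toFrame_injective
      rw [map_zero]
      ext i
      fin_cases i
      · exact h0
      · exact hw1
      · exact h2'.trans (by rw [hw1, map_zero]; rfl)
    · rw [← hauv, ← h2, h2']
      rfl
  obtain ⟨rfl, huv⟩ := eq_zero_of_forall_exists_eigenvector heig
  have hone : conjNorm F (u + v) = -1 := by
    have hw : ofFrame b H ![0, 1, f 1] ∈ α := by
      rw [hαf, hH.ofFrame_mem_graphPlane]
    have := (hmem _ hw).2
    rw [hH.toFrame_ofFrame_zero] at this
    simpa [hauv, conjNorm] using this
  refine ⟨u + v, hone, ?_⟩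
  rcases huv with rfl | rfl
  · right
    rw [hαf]
    congr 1
    ext x
    simp [hauv]
  · left
    rw [hαf]
    congr 1
    ext x
    simp [hauv]

theorem IsFrame.graphPlane_inf_ne_bot (hH : IsFrame F H π) {θ φ : K}
    (hθ : conjNorm F θ = -1) (hφ : conjNorm F φ = -1) :
    graphPlane b H (twist θ (frob F K)) ⊓
      graphPlane b H (twist φ ((frob F K).trans (frob F K))) ≠ ⊥ := by
  have hφ0 : φ ≠ 0 := by rintro rfl; simp [conjNorm] at hφ
  have h1 : conjNorm F (θ / φ) = 1 := by
    have h : conjNorm F (θ / φ) * conjNorm F φ = conjNorm F θ := by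
      rw [← conjNorm_mul, div_mul_cancel₀ _ hφ0]
    rw [hθ, hφ] at h
    linear_combination -h
  obtain ⟨z, hz, hz1⟩ := exists_frob_eq_mul h1
  rw [Submodule.ne_bot_iff]
  refine ⟨ofFrame b H ![0, σ (σ z), θ * z], ⟨?_, ?_⟩, fun h0 => ?_⟩
  · rw [SetLike.mem_coe, hH.ofFrame_mem_graphPlane, twist_apply, frob_cube]
  · rw [SetLike.mem_coe, hH.ofFrame_mem_graphPlane, twist_apply, AlgEquiv.trans_apply, frob_cube,
      hz1]
    field_simp
  · have := congrFun (congrArg (toFrame b H) h0) 1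
    rw [hH.toFrame_ofFrame_zero, map_zero] at this
    exact hz (by simpa using this)

theorem IsFrame.graphPlane_ne (hH : IsFrame F H π) {θ : K} (φ : K) (hθ : θ ≠ 0) :
    graphPlane b H (twist θ (frob F K)) ≠
      graphPlane b H (twist φ ((frob F K).trans (frob F K))) := by
  intro h
  have : ∀ x : K, 0 * x + θ * σ x + (-φ) * σ (σ x) = 0 := fun x => by
    have h1 : ofFrame b H ![0, x, θ * σ x] ∈ graphPlane b H (twist θ (frob F K)) :=
      hH.ofFrame_mem_graphPlane.2 rfl
    rw [h, hH.ofFrame_mem_graphPlane, twist_apply, AlgEquiv.trans_apply] at h1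
    linear_combination h1
  exact hθ (eq_zero_of_forall_linear this).2.1

/-- The exterior splash has no covers other than the planes `γ = θ σ(β)` and the planes
`γ = θ σ²(β)`. A plane of one kind meets every plane of the other kind, so the kinds do not mix. -/
theorem IsFrame.cover_eq (hH : IsFrame F H π) {X : Set (Submodule F (Vec7 F))}
    (hX : IsCover (splashPlanes b π) X) :
    X = twistPlanes b H (frob F K) ∨ X = twistPlanes b H ((frob F K).trans (frob F K)) := by
  obtain ⟨hcard, hplane, hdisj, hcover, hinter⟩ := hX
  have hform : ∀ α ∈ X, ∃ θ : K, conjNorm F θ = -1 ∧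
      (α = graphPlane b H (twist θ (frob F K)) ∨
      α = graphPlane b H (twist θ ((frob F K).trans (frob F K)))) := fun α hα =>
    hH.eq_graphPlane (hplane α hα).1 (fun v hv => by
      have : v ∈ ⋃ α ∈ X, (α : Set (Vec7 F)) := Set.mem_biUnion hα hv
      rw [hcover] at this
      simpa using this) (hinter α hα)
  have heq : ∀ τ : K ≃ₐ[F] K, X ⊆ twistPlanes b H τ → X = twistPlanes b H τ := fun τ hτ => by
    obtain ⟨hfin, hle⟩ := ncard_conjNorm_eq_neg_one_le F K
    refine Set.eq_of_subset_of_ncard_le hτ ?_ (hfin.image _)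
    rw [hcard]
    exact (Set.ncard_image_le hfin).trans hle
  by_cases h : ∃ α ∈ X, ∃ θ : K, conjNorm F θ = -1 ∧ α = graphPlane b H (twist θ (frob F K))
  · left
    obtain ⟨_, hα, θ, hθ, rfl⟩ := h
    refine heq _ fun β hβ => ?_
    obtain ⟨φ, hφ, rfl | rfl⟩ := hform β hβ
    · exact ⟨φ, hφ, rfl⟩
    · have hθ0 : θ ≠ 0 := by rintro rfl; simp [conjNorm] at hθ
      exact absurd (hdisj _ hα _ hβ (hH.graphPlane_ne φ hθ0)) (hH.graphPlane_inf_ne_bot hθ hφ)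
  · right
    refine heq _ fun β hβ => ?_
    obtain ⟨φ, hφ, h1 | rfl⟩ := hform β hβ
    · exact absurd ⟨β, hβ, φ, hφ, h1⟩ h
    · exact ⟨φ, hφ, rfl⟩

/-! ### The cubic extension of `PG(6,F)` and transversal lines -/

variable (F K) in
/-- The automorphism `σ ^ i` of `K`. -/
def conj (i : Fin 3) : K ≃ₐ[F] K := frob F K ^ (i : ℕ)

@[simp] theorem conj_zero (x : K) : conj F K 0 x = x := rfl

@[simp] theorem conj_one (x : K) : conj F K 1 x = σ x := rfl

@[simp] theorem conj_two (x : K) : conj F K 2 x = σ (σ x) := rfl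

theorem conj_add_one (i : Fin 3) (x : K) : conj F K (i + 1) x = σ (conj F K i x) := by
  fin_cases i
  · rfl
  · rfl
  · exact (frob_cube F K x).symm

theorem conj_frob (i : Fin 3) (x : K) : conj F K i (σ x) = conj F K (i + 1) x := by
  fin_cases i
  · rfl
  · rfl
  · exact frob_cube F K x

theorem conjNorm_conj (i : Fin 3) (x : K) : conjNorm F (conj F K i x) = conjNorm F x := by
  fin_cases i
  · rfl
  · exact conjNorm_frob x
  · exact (conjNorm_frob _).trans (conjNorm_frob x)

theorem conjEquiv_apply_eq (c : Fin 3 → K) (i : Fin 3) :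
    conjEquiv b c i = ∑ l, c l * conj F K i (b l) := by
  rw [conjEquiv_apply]
  fin_cases i <;> rfl

theorem conjEquiv_algebraMap_eq (c : Fin 3 → F) (i : Fin 3) :
    conjEquiv b (fun l => algebraMap F K (c l)) i = conj F K i (b.equivFun.symm c) := by
  rw [conjEquiv_algebraMap]
  fin_cases i <;> rfl

/-- The coordinates `(βᵢ, γᵢ, z)` on `PG(6,K)` in which the point of `PG(6,F)` with adapted
coordinates `(z, β, γ)` is `(σⁱ β, σⁱ γ, z)`. -/
def extFrame (b : Module.Basis (Fin 3) F K) (H : Vec3 K ≃ₗ[K] Vec3 K) : Vec7 K →ₗ[K] Vec7 K where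
  toFun w :=
    (fun i => conj F K i (H.symm ![(conj F K i).symm (conjEquiv b w.1 i),
      (conj F K i).symm (conjEquiv b w.2.1 i), (conj F K i).symm w.2.2] 1),
    fun i => conj F K i (H.symm ![(conj F K i).symm (conjEquiv b w.1 i),
      (conj F K i).symm (conjEquiv b w.2.1 i), (conj F K i).symm w.2.2] 2),
    w.2.2)
  map_add' v w := by
    have key : ∀ x x' y y' z z' : K, (![x + x', y + y', z + z'] : Vec3 K) =
        ![x, y, z] + ![x', y', z'] := fun x x' y y' z z' => by
      ext i; fin_cases i <;> rfl
    refine Prod.ext (funext fun i => ?_) (Prod.ext (funext fun i => ?_) rfl) <;>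
    simp only [Prod.fst_add, Prod.snd_add, map_add, Pi.add_apply, key]
  map_smul' c w := by
    have key : ∀ a x y z : K, (![a * x, a * y, a * z] : Vec3 K) = a • ![x, y, z] :=
        fun a x y z => by
      ext i; fin_cases i <;> rfl
    refine Prod.ext (funext fun i => ?_) (Prod.ext (funext fun i => ?_) rfl) <;>
    simp only [Prod.smul_fst, Prod.smul_snd, map_smul, Pi.smul_apply, smul_eq_mul, map_mul, key,
      AlgEquiv.apply_symm_apply, RingHom.id_apply]

theorem IsFrame.extFrame_extendVec (hH : IsFrame F H π) (w : Vec7 F) :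
    extFrame b H (extendVec K w) = (fun i => conj F K i (toFrame b H w 1),
      fun i => conj F K i (toFrame b H w 2), toFrame b H w 0) := by
  have key : ∀ i, (![(conj F K i).symm (conjEquiv b (extendVec K w).1 i),
      (conj F K i).symm (conjEquiv b (extendVec K w).2.1 i),
      (conj F K i).symm (extendVec K w).2.2] : Vec3 K) =
      ![b.equivFun.symm w.1, b.equivFun.symm w.2.1, algebraMap F K w.2.2] := fun i => by
    simp only [extendVec, conjEquiv_algebraMap_eq, AlgEquiv.symm_apply_apply, AlgEquiv.commutes]
  rw [hH.toFrame_zero]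
  refine Prod.ext (funext fun i => ?_) (Prod.ext (funext fun i => ?_) rfl)
  · exact congrArg (fun v => conj F K i (H.symm v 1)) (key i)
  · exact congrArg (fun v => conj F K i (H.symm v 2)) (key i)

theorem IsFrame.extFrame_ofFrame (hH : IsFrame F H π) {X : Vec3 K} {c : F}
    (hX : X 0 = algebraMap F K c) : extFrame b H (extendVec K (ofFrame b H X)) =
      (fun i => conj F K i (X 1), fun i => conj F K i (X 2), X 0) := by
  rw [hH.extFrame_extendVec, hH.toFrame_ofFrame hX]

theorem IsFrame.extFrame_injective (hH : IsFrame F H π) : Function.Injective (extFrame b H) := by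
  rw [← LinearMap.ker_eq_bot, LinearMap.ker_eq_bot']
  intro w hw
  have hz : w.2.2 = 0 := congrArg (fun v => v.2.2) hw
  have key : ∀ i, conjEquiv b w.1 i = 0 ∧ conjEquiv b w.2.1 i = 0 := fun i => by
    have h1 := congrFun (congrArg Prod.fst hw) i
    have h2 := congrFun (congrArg (fun v => v.2.1) hw) i
    simp only [extFrame, LinearMap.coe_mk, AddHom.coe_mk, hz, map_zero, Prod.fst_zero,
      Prod.snd_zero, Pi.zero_apply, map_eq_zero_iff _ (conj F K i).injective] at h1 h2
    set v : Vec3 K := ![(conj F K i).symm (conjEquiv b w.1 i),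
      (conj F K i).symm (conjEquiv b w.2.1 i), 0] with hv
    have h0 : H.symm v 0 = 0 := by
      rw [← hH.apply_two (H.symm v), LinearEquiv.apply_symm_apply]
      rfl
    have hs : H.symm v = 0 := by
      ext j
      fin_cases j <;> assumption
    have hv0 : v = 0 := by simpa using hs
    have e0 := congrFun hv0 0
    have e1 := congrFun hv0 1
    simpa [hv] using And.intro e0 e1
  refine Prod.ext ?_ (Prod.ext ?_ hz)
  · exact (conjEquiv b).map_eq_zero_iff.1 (funext fun i => (key i).1)
  · exact (conjEquiv b).map_eq_zero_iff.1 (funext fun i => (key i).2)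

/-- The line of `PG(6,K)` spanned by the coordinate points of `βⱼ` and `γᵢ`. -/
def coordLine (b : Module.Basis (Fin 3) F K) (H : Vec3 K ≃ₗ[K] Vec3 K) (j i : Fin 3) :
    Submodule K (Vec7 K) where
  carrier := {w | (∀ k, k ≠ j → (extFrame b H w).1 k = 0) ∧
    (∀ k, k ≠ i → (extFrame b H w).2.1 k = 0) ∧ (extFrame b H w).2.2 = 0}
  add_mem' := by
    rintro v w ⟨h1, h2, h3⟩ ⟨h4, h5, h6⟩
    refine ⟨fun k hk => ?_, fun k hk => ?_, ?_⟩
    · simp [h1 k hk, h4 k hk]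
    · simp [h2 k hk, h5 k hk]
    · simp [h3, h6]
  zero_mem' := by simp
  smul_mem' := by
    rintro c w ⟨h1, h2, h3⟩
    refine ⟨fun k hk => ?_, fun k hk => ?_, ?_⟩
    · simp [h1 k hk]
    · simp [h2 k hk]
    · simp [h3]

theorem mem_coordLine {j i : Fin 3} {w : Vec7 K} : w ∈ coordLine b H j i ↔
    (∀ k, k ≠ j → (extFrame b H w).1 k = 0) ∧
    (∀ k, k ≠ i → (extFrame b H w).2.1 k = 0) ∧ (extFrame b H w).2.2 = 0 := Iff.rfl

theorem IsFrame.extFrame_surjective (hH : IsFrame F H π) : Function.Surjective (extFrame b H) :=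
  LinearMap.injective_iff_surjective.1 hH.extFrame_injective

theorem IsFrame.finrank_coordLine (hH : IsFrame F H π) (j i : Fin 3) :
    Module.finrank K (coordLine b H j i) = 2 := by
  let f : coordLine b H j i →ₗ[K] K × K :=
    (LinearMap.proj (R := K) (φ := fun _ : Fin 3 => K) j ∘ₗ LinearMap.fst K _ _ ∘ₗ
      extFrame b H ∘ₗ (coordLine b H j i).subtype).prod
    (LinearMap.proj (R := K) (φ := fun _ : Fin 3 => K) i ∘ₗ LinearMap.fst K _ _ ∘ₗ
      LinearMap.snd K _ _ ∘ₗ extFrame b H ∘ₗ (coordLine b H j i).subtype)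
  have hf : ∀ w, f w = ((extFrame b H w).1 j, (extFrame b H w).2.1 i) := fun _ => rfl
  have hbij : Function.Bijective f := by
    constructor
    · rw [← LinearMap.ker_eq_bot, LinearMap.ker_eq_bot']
      rintro ⟨w, h1, h2, h3⟩ hw
      rw [hf] at hw
      apply Subtype.ext
      apply hH.extFrame_injective (b := b)
      rw [Submodule.coe_zero, map_zero]
      refine Prod.ext (funext fun k => ?_) (Prod.ext (funext fun k => ?_) h3)
      · by_cases hk : k = j
        · rw [hk]; exact congrArg Prod.fst hw
        · exact h1 k hk
      · by_cases hk : k = i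
        · rw [hk]; exact congrArg Prod.snd hw
        · exact h2 k hk
    · rintro ⟨c, d⟩
      obtain ⟨w, hw⟩ := hH.extFrame_surjective (b := b) (Pi.single j c, Pi.single i d, 0)
      refine ⟨⟨w, mem_coordLine.2 ⟨fun k hk => ?_, fun k hk => ?_, ?_⟩⟩, ?_⟩
      · rw [hw]; simp [hk]
      · rw [hw]; simp [hk]
      · rw [hw]
      · rw [hf]; simp [hw]
  rw [(LinearEquiv.ofBijective f hbij).finrank_eq]
  simp

theorem IsFrame.coordLine_injective (hH : IsFrame F H π) (ρ : Fin 3 → Fin 3) :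
    Function.Injective fun i => coordLine b H (ρ i) i := by
  intro i i' h
  by_contra hne
  obtain ⟨w, hw⟩ := hH.extFrame_surjective (b := b) (0, Pi.single i 1, 0)
  have h1 : w ∈ coordLine b H (ρ i) i := by
    rw [mem_coordLine, hw]
    refine ⟨fun _ _ => rfl, fun k hk => ?_, rfl⟩
    simp [hk]
  have h' : coordLine b H (ρ i) i = coordLine b H (ρ i') i' := h
  rw [h', mem_coordLine, hw] at h1
  simpa using h1.2.1 i hne

theorem IsFrame.extFrame_of_mem_extendSubspace (hH : IsFrame F H π) {τ : K ≃ₐ[F] K} {ρ : Fin 3 → Fin 3}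
    (hρ : ∀ i x, conj F K i (τ x) = conj F K (ρ i) x) {θ : K} {w : Vec7 K}
    (hw : w ∈ extendSubspace K (graphPlane b H (twist θ τ))) (i : Fin 3) :
    (extFrame b H w).2.1 i = conj F K i θ * (extFrame b H w).1 (ρ i) := by
  induction hw using Submodule.span_induction with
  | mem x hx =>
    obtain ⟨v, hv, rfl⟩ := hx
    rw [hH.extFrame_extendVec]
    simp only
    rw [(mem_graphPlane.1 hv).2, twist_apply, map_mul, hρ]
  | zero => simp
  | add x y _ _ hx hy => simp [hx, hy, mul_add]
  | smul a x _ hx => simp [hx]; ring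

/-- The extension of a plane that contains all points `(0, μ x, ν τ(x))` meets the coordinate
lines of `β_{ρ i}` and `γᵢ`. -/
theorem IsFrame.coordLine_inf_ne_bot (hH : IsFrame F H π) {τ : K ≃ₐ[F] K} (ρ : Equiv.Perm (Fin 3))
    (hρ : ∀ i x, conj F K i (τ x) = conj F K (ρ i) x) {μ ν : K} (hμν : μ ≠ 0 ∨ ν ≠ 0)
    {α : Submodule F (Vec7 F)} (hα : ∀ x, ofFrame b H ![0, μ * x, ν * τ x] ∈ α) (i : Fin 3) :
    coordLine b H (ρ i) i ⊓ extendSubspace K α ≠ ⊥ := by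
  obtain ⟨c, hc⟩ := (conjEquiv b).surjective (Pi.single (ρ i) 1)
  have hcj : ∀ j, ∑ l, c l * conj F K j (b l) = (Pi.single (ρ i) 1 : Fin 3 → K) j := fun j => by
    rw [← hc, conjEquiv_apply_eq]
  let v : Vec7 K := ∑ l, c l • extendVec K (ofFrame b H ![0, μ * b l, ν * τ (b l)])
  have hv : extFrame b H v = (fun j => conj F K j μ * (Pi.single (ρ i) 1 : Fin 3 → K) j,
      fun j => conj F K j ν * (Pi.single (ρ i) 1 : Fin 3 → K) (ρ j), 0) := by
    simp only [v, map_sum, map_smul]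
    have : ∀ l, extFrame b H (extendVec K (ofFrame b H ![0, μ * b l, ν * τ (b l)])) =
        (fun j => conj F K j (μ * b l), fun j => conj F K j (ν * τ (b l)), 0) := fun l =>
      hH.extFrame_ofFrame (c := 0) (by simp)
    simp only [this, map_mul, hρ]
    refine Prod.ext (funext fun j => ?_) (Prod.ext (funext fun j => ?_) ?_)
    · simp only [Prod.fst_sum, Finset.sum_apply, Prod.smul_fst, Pi.smul_apply, smul_eq_mul, ← hcj,
        Finset.mul_sum]
      exact Finset.sum_congr rfl fun l _ => by ring
    · simp only [Prod.fst_sum, Prod.snd_sum, Finset.sum_apply, Prod.smul_fst, Prod.smul_snd,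
        Pi.smul_apply, smul_eq_mul, ← hcj, Finset.mul_sum]
      exact Finset.sum_congr rfl fun l _ => by ring
    · simp [Prod.snd_sum]
  rw [Submodule.ne_bot_iff]
  refine ⟨v, ⟨mem_coordLine.2 ?_, ?_⟩, fun h0 => ?_⟩
  · rw [hv]
    refine ⟨fun k hk => ?_, fun k hk => ?_, rfl⟩
    · simp [hk]
    · simp [hk]
  · exact Submodule.sum_mem _ fun l _ => Submodule.smul_mem _ _
      (Submodule.subset_span ⟨_, hα _, rfl⟩)
  · rw [h0, map_zero] at hv
    have h1 := congrFun (congrArg Prod.fst hv) (ρ i)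
    have h2 := congrFun (congrArg (fun w => w.2.1) hv) i
    simp only [Prod.fst_zero, Prod.snd_zero, Pi.zero_apply, Pi.single_eq_same, mul_one] at h1 h2
    rcases hμν with h | h
    · exact h ((map_eq_zero_iff _ (conj F K (ρ i)).injective).1 h1.symm)
    · exact h ((map_eq_zero_iff _ (conj F K i).injective).1 h2.symm)

/-- If `(V - φ U, Z - φ W)` and `(V' - σ(φ) U', Z' - σ(φ) W')` are dependent for all `φ` of norm
`-1`, then each of `(U, W)`, `(V, Z)` is dependent on each of `(U', W')`, `(V', Z')`. -/
theorem minors_eq_zero {U V W Z U' V' W' Z' : K}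
    (h : ∀ φ : K, conjNorm F φ = -1 →
      (V - φ * U) * (Z' - σ φ * W') - (V' - σ φ * U') * (Z - φ * W) = 0) :
    V * Z' = V' * Z ∧ U * Z' = V' * W ∧ V * W' = U' * Z ∧ U * W' = U' * W := by
  have key : ∀ y : K, 0 * y ^ 2 + (U * Z' - V' * W) * σ y ^ 2 + 0 * σ (σ y) ^ 2 +
      (U * W' - U' * W) * (σ y * σ (σ y)) + (V * W' - U' * Z) * (y * σ (σ y)) +
      (V * Z' - V' * Z) * (y * σ y) = 0 := fun y => by
    by_cases hy : y = 0
    · simp [hy]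
    · have hy1 : σ y ≠ 0 := by simpa using hy
      have := h (-(σ y / y)) (by rw [conjNorm_neg, conjNorm_frob_div hy])
      simp only [map_neg, map_div₀] at this
      field_simp at this
      linear_combination this
  obtain ⟨-, h1, -, h2, h3, h4⟩ := eq_zero_of_forall_quadratic key
  exact ⟨sub_eq_zero.1 h4, sub_eq_zero.1 h1, sub_eq_zero.1 h3, sub_eq_zero.1 h2⟩

/-- The only lines that meet the extensions of all planes `γ = θ τ(β)`, `N(θ) = -1`, are three lines
spanned by coordinate points. Here `ρ` describes the effect of `τ` on the conjugates. -/
theorem IsFrame.transversals_subset (hH : IsFrame F H π) {τ : K ≃ₐ[F] K}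
    (ρ : Equiv.Perm (Fin 3)) (hρ : ∀ i x, conj F K i (τ x) = conj F K (ρ i) x)
    {X : Set (Submodule F (Vec7 F))} (hX : twistPlanes b H τ ⊆ X) {g : Submodule K (Vec7 K)}
    (hg : g ∈ transversals K X) : ∃ i, g = coordLine b H (ρ i) i := by
  obtain ⟨hg2, hgS, hgX⟩ := hg
  let B := Module.finBasisOfFinrankEq K g hg2
  let p : Vec7 K := B 0
  let q : Vec7 K := B 1
  have hgpq : ∀ v ∈ g, ∃ c d : K, v = c • p + d • q := fun v hv => by
    have := B.sum_repr ⟨v, hv⟩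
    rw [Fin.sum_univ_two] at this
    exact ⟨_, _, (congrArg Subtype.val this).symm⟩
  have hind : ∀ c d : K, c • p + d • q = 0 → c = 0 ∧ d = 0 := fun c d hcd => by
    have h := Fintype.linearIndependent_iff.1 B.linearIndependent ![c, d] (by
      rw [Fin.sum_univ_two]
      exact Subtype.ext hcd)
    exact ⟨h 0, h 1⟩
  have hpg : p ∈ g := (B 0).2
  have hqg : q ∈ g := (B 1).2
  let U (i : Fin 3) := (extFrame b H p).1 (ρ i)
  let V (i : Fin 3) := (extFrame b H p).2.1 i
  let W (i : Fin 3) := (extFrame b H q).1 (ρ i)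
  let Z (i : Fin 3) := (extFrame b H q).2.1 i
  have hzero : ∀ v ∈ g, (extFrame b H v).2.2 = 0 := fun v hv => hgS hv
  -- Minors of adjacent blocks of coordinates.
  have hstep : ∀ i, V i * Z (i + 1) = V (i + 1) * Z i ∧ U i * Z (i + 1) = V (i + 1) * W i ∧
      V i * W (i + 1) = U (i + 1) * Z i ∧ U i * W (i + 1) = U (i + 1) * W i := fun i => by
    refine minors_eq_zero (F := F) fun φ hφ => ?_
    -- With this `θ`, the `i`-th and the next conjugate of `θ` are `φ` and `σ φ`.
    set θ := (conj F K i).symm φ with hθ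
    have hθi : conj F K i θ = φ := by rw [hθ, AlgEquiv.apply_symm_apply]
    have hθn : conjNorm F θ = -1 := by rw [← conjNorm_conj i, hθi, hφ]
    have hθi1 : conj F K (i + 1) θ = σ φ := by rw [conj_add_one, hθi]
    obtain ⟨v, ⟨hvg, hvα⟩, hv0⟩ := (Submodule.ne_bot_iff _).1 (hgX _ (hX ⟨θ, hθn, rfl⟩))
    obtain ⟨c, d, rfl⟩ := hgpq v hvg
    have e₀ := hH.extFrame_of_mem_extendSubspace hρ hvα i
    have e₁ := hH.extFrame_of_mem_extendSubspace hρ hvα (i + 1)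
    rw [hθi] at e₀
    rw [hθi1] at e₁
    simp only [map_add, map_smul, Prod.fst_add, Prod.snd_add, Pi.add_apply, Prod.smul_fst,
      Prod.smul_snd, Pi.smul_apply, smul_eq_mul] at e₀ e₁
    have e₀' : c * (V i - φ * U i) + d * (Z i - φ * W i) = 0 := by
      simp only [U, V, W, Z]; linear_combination e₀
    have e₁' : c * (V (i + 1) - σ φ * U (i + 1)) + d * (Z (i + 1) - σ φ * W (i + 1)) = 0 := by
      simp only [U, V, W, Z]; linear_combination e₁
    have hc : c * ((V i - φ * U i) * (Z (i + 1) - σ φ * W (i + 1)) -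
        (V (i + 1) - σ φ * U (i + 1)) * (Z i - φ * W i)) = 0 := by
      linear_combination (Z (i + 1) - σ φ * W (i + 1)) * e₀' - (Z i - φ * W i) * e₁'
    have hd : d * ((V i - φ * U i) * (Z (i + 1) - σ φ * W (i + 1)) -
        (V (i + 1) - σ φ * U (i + 1)) * (Z i - φ * W i)) = 0 := by
      linear_combination (V i - φ * U i) * e₁' - (V (i + 1) - σ φ * U (i + 1)) * e₀'
    by_contra hne
    have hc0 := (mul_eq_zero.1 hc).resolve_right hne
    have hd0 := (mul_eq_zero.1 hd).resolve_right hne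
    exact hv0 (by rw [hc0, hd0, zero_smul, zero_smul, add_zero])
  have hminor : ∀ i k, i ≠ k → V i * Z k = V k * Z i ∧ U i * Z k = V k * W i ∧
      V i * W k = U k * Z i ∧ U i * W k = U k * W i := fun i k hik => by
    have : k = i + 1 ∨ i = k + 1 := by revert i k; decide
    rcases this with rfl | rfl
    · exact hstep i
    · obtain ⟨h1, h2, h3, h4⟩ := hstep k
      exact ⟨h1.symm, h3.symm, h2.symm, h4.symm⟩
  by_cases hdet : ∃ i, U i * Z i - V i * W i ≠ 0
  · obtain ⟨i, hi⟩ := hdet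
    refine ⟨i, ?_⟩
    have hvan : ∀ k, k ≠ i → U k = 0 ∧ W k = 0 ∧ V k = 0 ∧ Z k = 0 := fun k hk => by
      obtain ⟨h1, h2, h3, h4⟩ := hminor i k hk.symm
      refine ⟨?_, ?_, ?_, ?_⟩ <;> apply (mul_eq_zero.1 ?_).resolve_right hi
      · linear_combination -U i * h3 + V i * h4
      · linear_combination -W i * h3 + Z i * h4
      · linear_combination -U i * h1 + V i * h2
      · linear_combination -W i * h1 + Z i * h2
    have hmem : ∀ v ∈ g, v ∈ coordLine b H (ρ i) i := by
      intro v hv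
      have hv0 := hzero v hv
      obtain ⟨c, d, rfl⟩ := hgpq v hv
      rw [mem_coordLine]
      refine ⟨fun k hk => ?_, fun k hk => ?_, hv0⟩
      · obtain ⟨k', rfl⟩ := ρ.surjective k
        obtain ⟨h1, h2, -, -⟩ := hvan k' (fun h => hk (by rw [h]))
        simp only [map_add, map_smul, Prod.fst_add, Pi.add_apply, Prod.smul_fst, Pi.smul_apply,
          smul_eq_mul]
        linear_combination c * h1 + d * h2
      · obtain ⟨-, -, h1, h2⟩ := hvan k hk
        simp only [map_add, map_smul, Prod.fst_add, Prod.snd_add, Pi.add_apply, Prod.smul_fst,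
          Prod.smul_snd, Pi.smul_apply, smul_eq_mul]
        linear_combination c * h1 + d * h2
    exact Submodule.eq_of_le_of_finrank_eq hmem (by rw [hg2, hH.finrank_coordLine])
  · -- All minors vanish, so that `p` and `q` would be dependent.
    exfalso
    push Not at hdet
    have hcol : ∀ s t : K, (∀ k, s * U k + t * W k = 0) → (∀ k, s * V k + t * Z k = 0) →
        s = 0 ∧ t = 0 := fun s t h1 h2 => by
      apply hind
      apply hH.extFrame_injective (b := b)
      rw [map_zero]
      refine Prod.ext (funext fun k => ?_) (Prod.ext (funext fun k => ?_) (hzero _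
        (g.add_mem (g.smul_mem _ hpg) (g.smul_mem _ hqg))))
      · obtain ⟨k', rfl⟩ := ρ.surjective k
        simpa [U, W] using h1 k'
      · simpa [V, Z] using h2 k
    have hU : ∀ i, W i = 0 ∧ -U i = 0 := fun i => by
      refine hcol _ _ (fun k => ?_) fun k => ?_ <;> rcases eq_or_ne i k with rfl | hik
      · ring
      · linear_combination -(hminor i k hik).2.2.2
      · linear_combination -(hdet i)
      · linear_combination -(hminor i k hik).2.1
    have hV : ∀ i, Z i = 0 ∧ -V i = 0 := fun i => by
      refine hcol _ _ (fun k => ?_) fun k => ?_ <;> rcases eq_or_ne i k with rfl | hik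
      · linear_combination hdet i
      · linear_combination -(hminor i k hik).2.2.1
      · ring
      · linear_combination -(hminor i k hik).1
    exact one_ne_zero (hcol 1 0 (fun k => by linear_combination -(hU k).2)
      fun k => by linear_combination -(hV k).2).1

theorem IsFrame.transversals_eq (hH : IsFrame F H π) {τ : K ≃ₐ[F] K}
    (ρ : Equiv.Perm (Fin 3)) (hρ : ∀ i x, conj F K i (τ x) = conj F K (ρ i) x)
    {X : Set (Submodule F (Vec7 F))} (hX : twistPlanes b H τ ⊆ X)
    (hmeet : ∀ α ∈ X, ∀ i, coordLine b H (ρ i) i ⊓ extendSubspace K α ≠ ⊥) :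
    transversals K X = Set.range fun i => coordLine b H (ρ i) i := by
  ext g
  constructor
  · intro hg
    obtain ⟨i, rfl⟩ := hH.transversals_subset ρ hρ hX hg
    exact ⟨i, rfl⟩
  · rintro ⟨i, rfl⟩
    exact ⟨hH.finrank_coordLine _ _, fun v hv => (mem_coordLine.1 hv).2.2, fun α hα => hmeet α hα i⟩

theorem IsFrame.ncard_range_coordLine (hH : IsFrame F H π) (ρ : Fin 3 → Fin 3) :
    (Set.range fun i => coordLine b H (ρ i) i).ncard = 3 := by
  rw [← Set.image_univ, Set.ncard_image_of_injective _ (hH.coordLine_injective ρ),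
    Set.ncard_univ, Nat.card_eq_fintype_card, Fintype.card_fin]

/-- The transversal lines of the cover `γ = θ σ(β)`. -/
theorem IsFrame.transversals_twistPlanes_frob (hH : IsFrame F H π) :
    transversals K (twistPlanes b H (frob F K)) =
      Set.range fun i => coordLine b H (i + 1) i := by
  refine hH.transversals_eq (Equiv.addRight 1) conj_frob subset_rfl ?_
  rintro _ ⟨θ, hθ, rfl⟩ i
  refine hH.coordLine_inf_ne_bot (Equiv.addRight 1) conj_frob (μ := 1) (ν := θ)
    (Or.inl one_ne_zero) (fun x => ?_) i
  rw [hH.ofFrame_mem_graphPlane, one_mul, twist_apply]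

/-- The transversal lines of the regular spread. -/
theorem IsFrame.transversals_spread (hH : IsFrame F H π) :
    transversals K (spread b) = Set.range fun i => coordLine b H i i := by
  refine hH.transversals_eq (τ := 1) (Equiv.refl _) (fun _ _ => rfl) ?_ ?_
  · rw [← hH.splashPlanes_eq]
    exact Set.image_mono fun T hT => hT.1
  · rintro _ ⟨T, hT, rfl⟩ i
    have hT0 := T.rep_nonzero
    have hT2 : T.rep 2 = 0 := by
      have : OnSubspace T (lineAtInfinity K) := hT
      rwa [← T.mk_rep, mk_onSubspace_iff] at this
    obtain ⟨X, hX⟩ := H.surjective T.rep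
    have hX0 : X 0 = 0 := by rw [← hH.apply_two X, hX, hT2]
    have hX' : X = ![0, X 1, X 2] := by
      ext j; fin_cases j
      · exact hX0
      · rfl
      · rfl
    have hv : H ![0, X 1, X 2] ≠ 0 := by rwa [← hX', hX]
    have hTeq : T = Projectivization.mk K _ hv := by
      conv_lhs => rw [← T.mk_rep]
      congr 1
      rw [← hX', hX]
    refine hH.coordLine_inf_ne_bot (τ := 1) (Equiv.refl _) (fun _ _ => rfl) (μ := X 1) (ν := X 2)
      ?_ (fun x => ?_) i
    · by_contra! h
      apply hv
      rw [h.1, h.2]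
      simp
    · rw [hTeq, hH.mem_spreadPlane]
      refine ⟨x, ?_⟩
      rw [hH.toFrame_ofFrame_zero, AlgEquiv.one_apply, mul_comm, mul_comm (X 2)]

/-! ### Twisted cubics from products of conjugate linear forms -/

variable (F) in
/-- The linear form `L_i(s, t) = s σⁱ(y₀) + t σⁱ(y₁)`. -/
def conjForm (y₀ y₁ : K) (i : Fin 3) (s t : K) : K := s * conj F K i y₀ + t * conj F K i y₁

variable (F) in
/-- The coefficients of the binary cubic form `L_i L_j L_k`. -/
def formCoeff (y₀ y₁ : K) (i j k : Fin 3) : Fin 4 → K :=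
  ![conj F K i y₀ * conj F K j y₀ * conj F K k y₀,
    conj F K i y₀ * conj F K j y₀ * conj F K k y₁ + conj F K i y₀ * conj F K j y₁ * conj F K k y₀ +
      conj F K i y₁ * conj F K j y₀ * conj F K k y₀,
    conj F K i y₀ * conj F K j y₁ * conj F K k y₁ + conj F K i y₁ * conj F K j y₀ * conj F K k y₁ +
      conj F K i y₁ * conj F K j y₁ * conj F K k y₀,
    conj F K i y₁ * conj F K j y₁ * conj F K k y₁]

theorem formCoeff_eval (y₀ y₁ : K) (i j k : Fin 3) (s t : K) :
    s ^ 3 * formCoeff F y₀ y₁ i j k 0 + s ^ 2 * t * formCoeff F y₀ y₁ i j k 1 +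
      s * t ^ 2 * formCoeff F y₀ y₁ i j k 2 + t ^ 3 * formCoeff F y₀ y₁ i j k 3 =
    conjForm F y₀ y₁ i s t * conjForm F y₀ y₁ j s t * conjForm F y₀ y₁ k s t := by
  simp only [formCoeff, conjForm, Matrix.cons_val]
  ring

theorem conj_add (i k : Fin 3) (x : K) : conj F K k (conj F K i x) = conj F K (i + k) x := by
  fin_cases i <;> fin_cases k <;> first | rfl | exact frob_cube F K x | skip
  exact congrArg (frob F K) (frob_cube F K x)

theorem conj_formCoeff (y₀ y₁ : K) (i j k l : Fin 3) (n : Fin 4) :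
    conj F K l (formCoeff F y₀ y₁ i j k n) = formCoeff F y₀ y₁ (i + l) (j + l) (k + l) n := by
  fin_cases n <;>
    simp only [formCoeff, map_add, map_mul, conj_add, Fin.zero_eta, Fin.mk_one, Fin.reduceFinMk,
      Matrix.cons_val]

theorem exists_algebraMap_eq_formCoeff (y₀ y₁ : K) (n : Fin 4) :
    ∃ c : F, formCoeff F y₀ y₁ 0 1 2 n = algebraMap F K c := by
  obtain ⟨c, hc⟩ := exists_algebraMap_eq (F := F) (x := formCoeff F y₀ y₁ 0 1 2 n) (by
    fin_cases n <;>
      (simp [formCoeff, frob_cube]; try ring))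
  exact ⟨c, hc.symm⟩

theorem conjForm_root (y₀ y₁ : K) (i : Fin 3) :
    conjForm F y₀ y₁ i (conj F K i y₁) (-conj F K i y₀) = 0 := by
  simp only [conjForm]; ring

theorem conjForm_zero_mul_one_mul_two_root (y₀ y₁ : K) (i : Fin 3) :
    conjForm F y₀ y₁ 0 (conj F K i y₁) (-conj F K i y₀) *
      conjForm F y₀ y₁ 1 (conj F K i y₁) (-conj F K i y₀) *
      conjForm F y₀ y₁ 2 (conj F K i y₁) (-conj F K i y₀) = 0 := by
  have h := conjForm_root (F := F) y₀ y₁ i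
  fin_cases i <;> simp_all

theorem conjForm_ne_zero {y₀ y₁ : K} (hD : conjDet F y₀ y₁ ≠ 0) {i k : Fin 3} (hik : i ≠ k) :
    conjForm F y₀ y₁ k (conj F K i y₁) (-conj F K i y₀) ≠ 0 := by
  have h1 : ∀ i, conj F K i (conjDet F y₀ y₁) ≠ 0 := fun i h =>
    hD ((map_eq_zero_iff _ (conj F K i).injective).1 h)
  have hk : k = i + 1 ∨ i = k + 1 := by revert i k; decide
  rcases hk with rfl | rfl
  · intro h
    apply h1 i
    simp only [conjForm, conjDet, map_sub, map_mul, conj_frob] at *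
    linear_combination -h
  · intro h
    apply h1 k
    simp only [conjForm, conjDet, map_sub, map_mul, conj_frob] at *
    linear_combination h

theorem exists_forall_add_eq_or : ∀ p r i : Fin 3, p ≠ r →
    ∃ l, l ≠ p + i ∧ l ≠ r + i ∧ ∀ k, k ≠ i → p + k = l ∨ r + k = l := by
  decide

/-- The four forms `L_p² L_r` (with `p - r` fixed) and `L₀ L₁ L₂` are independent, as one sees from
their values at the roots of the `L_i`. Hence no functional vanishes on all of them. -/
theorem eq_zero_of_sum_formCoeff_eq_zero {y₀ y₁ : K} (hD : conjDet F y₀ y₁ ≠ 0) {p r : Fin 3}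
    (hpr : p ≠ r) {c : Fin 4 → K}
    (hN : ∑ n, formCoeff F y₀ y₁ 0 1 2 n * c n = 0)
    (hQ : ∀ i, ∑ n, formCoeff F y₀ y₁ (p + i) (p + i) (r + i) n * c n = 0) : c = 0 := by
  let M : Matrix (Fin 4) (Fin 4) K := Matrix.of
    (Fin.cons (formCoeff F y₀ y₁ 0 1 2) fun i => formCoeff F y₀ y₁ (p + i) (p + i) (r + i))
  have hM0 : ∀ n, M 0 n = formCoeff F y₀ y₁ 0 1 2 n := fun n => rfl
  have hM : ∀ i n, M (Fin.succ i) n = formCoeff F y₀ y₁ (p + i) (p + i) (r + i) n := fun i n => rfl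
  have hdet : M.det ≠ 0 := by
    intro h0
    obtain ⟨v, hv, hvM⟩ := Matrix.exists_vecMul_eq_zero_iff.2 h0
    have hform : ∀ s t : K, v 0 * (conjForm F y₀ y₁ 0 s t * conjForm F y₀ y₁ 1 s t *
        conjForm F y₀ y₁ 2 s t) + ∑ i, v (Fin.succ i) * (conjForm F y₀ y₁ (p + i) s t *
        conjForm F y₀ y₁ (p + i) s t * conjForm F y₀ y₁ (r + i) s t) = 0 := fun s t => by
      have hcol : ∀ n, v 0 * formCoeff F y₀ y₁ 0 1 2 n +
          ∑ i, v (Fin.succ i) * formCoeff F y₀ y₁ (p + i) (p + i) (r + i) n = 0 := fun n => by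
        have := congrFun hvM n
        simpa [Matrix.vecMul, dotProduct, Fin.sum_univ_succ (n := 3), hM0, hM] using this
      simp only [← formCoeff_eval, Fin.sum_univ_three] at hcol ⊢
      linear_combination s ^ 3 * hcol 0 + s ^ 2 * t * hcol 1 + s * t ^ 2 * hcol 2 + t ^ 3 * hcol 3
    have hsucc : ∀ i, v (Fin.succ i) = 0 := fun i => by
      obtain ⟨l, h1, h2, h3⟩ := exists_forall_add_eq_or p r i hpr
      have h := hform (conj F K l y₁) (-conj F K l y₀)
      rw [conjForm_zero_mul_one_mul_two_root, mul_zero, zero_add, Finset.sum_eq_single i] at h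
      · simpa [conjForm_ne_zero hD h1, conjForm_ne_zero hD h2] using h
      · intro k _ hk
        rcases h3 k hk with h4 | h4 <;> rw [h4, conjForm_root] <;> ring
      · simp
    have hzero : v 0 = 0 := by
      have h := hform 1 0
      have hy : y₀ ≠ 0 := by rintro rfl; simp [conjDet] at hD
      simpa [hsucc, conjForm, hy] using h
    apply hv
    funext n
    refine Fin.cases hzero hsucc n
  apply Matrix.eq_zero_of_mulVec_eq_zero hdet
  funext n
  refine Fin.cases ?_ (fun i => ?_) n
  · simpa [Matrix.mulVec, dotProduct, hM0] using hN
  · simpa [Matrix.mulVec, dotProduct, hM] using hQ i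

/-- The coefficient vectors of the curve with adapted coordinates
`(L₀ L₁ L₂, L_p² L_r, L_u² L_v)`. -/
def formVec (b : Module.Basis (Fin 3) F K) (H : Vec3 K ≃ₗ[K] Vec3 K) (y₀ y₁ : K)
    (p r u v : Fin 3) (n : Fin 4) : Vec7 F :=
  ofFrame b H ![formCoeff F y₀ y₁ 0 1 2 n, formCoeff F y₀ y₁ p p r n, formCoeff F y₀ y₁ u u v n]

theorem IsFrame.toFrame_formVec (hH : IsFrame F H π) (y₀ y₁ : K) (p r u v : Fin 3) (n : Fin 4) :
    toFrame b H (formVec b H y₀ y₁ p r u v n) =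
      ![formCoeff F y₀ y₁ 0 1 2 n, formCoeff F y₀ y₁ p p r n, formCoeff F y₀ y₁ u u v n] := by
  obtain ⟨c, hc⟩ := exists_algebraMap_eq_formCoeff (F := F) y₀ y₁ n
  exact hH.toFrame_ofFrame (c := c) (by simpa using hc)

theorem IsFrame.extFrame_cubicVec (hH : IsFrame F H π) (y₀ y₁ : K) (p r u v : Fin 3) (s t : K) :
    extFrame b H (cubicVec (fun n => extendVec K (formVec b H y₀ y₁ p r u v n)) s t) =
      (fun i => conjForm F y₀ y₁ (p + i) s t * conjForm F y₀ y₁ (p + i) s t *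
          conjForm F y₀ y₁ (r + i) s t,
        fun i => conjForm F y₀ y₁ (u + i) s t * conjForm F y₀ y₁ (u + i) s t *
          conjForm F y₀ y₁ (v + i) s t,
        conjForm F y₀ y₁ 0 s t * conjForm F y₀ y₁ 1 s t * conjForm F y₀ y₁ 2 s t) := by
  simp only [cubicVec, map_add, map_smul, hH.extFrame_extendVec, hH.toFrame_formVec,
    Matrix.cons_val, conj_formCoeff, ← formCoeff_eval]
  rfl

/-- A relation over `F` between the coefficient vectors is preserved by `σ`, so that it yields a
functional that vanishes on all conjugates of the coordinate forms. -/
theorem IsFrame.linearIndependent_formVec (hH : IsFrame F H π) {y₀ y₁ : K}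
    (hD : conjDet F y₀ y₁ ≠ 0) {p r : Fin 3} (hpr : p ≠ r) (u v : Fin 3) :
    LinearIndependent F (formVec b H y₀ y₁ p r u v) := by
  rw [Fintype.linearIndependent_iff]
  intro c hc n
  have hc' := congrArg (toFrame b H) hc
  simp only [map_sum, map_smul, map_zero, hH.toFrame_formVec] at hc'
  have h0 : ∑ n, formCoeff F y₀ y₁ 0 1 2 n * algebraMap F K (c n) = 0 := by
    have := congrFun hc' 0
    simpa [Finset.sum_apply, Algebra.smul_def, mul_comm] using this
  have h1 : ∑ n, formCoeff F y₀ y₁ p p r n * algebraMap F K (c n) = 0 := by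
    have := congrFun hc' 1
    simpa [Finset.sum_apply, Algebra.smul_def, mul_comm] using this
  have := eq_zero_of_sum_formCoeff_eq_zero hD hpr (c := fun n => algebraMap F K (c n)) h0
    fun i => by
      have h := congrArg (conj F K i) h1
      simpa only [map_sum, map_mul, map_zero, conj_formCoeff, AlgEquiv.commutes] using h
  simpa using congrFun this n

/-- The twisted cubic with coefficient vectors `formVec`. -/
def IsFrame.cubic (hH : IsFrame F H π) (b : Module.Basis (Fin 3) F K) {y₀ y₁ : K}
    (hD : conjDet F y₀ y₁ ≠ 0) {p r : Fin 3} (hpr : p ≠ r) (u v : Fin 3) : TwistedCubic F where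
  m := formVec b H y₀ y₁ p r u v
  indep := hH.linearIndependent_formVec hD hpr u v

/-- The 3-space of the cubic has the equation `γ = θ τ(β) + δ z` if the coefficients satisfy it. -/
theorem IsFrame.graphPlane_le_space (hH : IsFrame F H π) {y₀ y₁ : K}
    (hD : conjDet F y₀ y₁ ≠ 0) {p r : Fin 3} (hpr : p ≠ r) {u v : Fin 3} {τ : K ≃ₐ[F] K} {θ δ : K}
    (hrel : ∀ n, formCoeff F y₀ y₁ u u v n =
      θ * τ (formCoeff F y₀ y₁ p p r n) + δ * formCoeff F y₀ y₁ 0 1 2 n) :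
    graphPlane b H (twist θ τ) ≤ (hH.cubic b hD hpr u v).space := by
  let f : Vec7 F →ₗ[F] K :=
    LinearMap.proj (R := F) (φ := fun _ : Fin 3 => K) 2 ∘ₗ toFrame b H -
      twist θ τ ∘ₗ LinearMap.proj (R := F) (φ := fun _ : Fin 3 => K) 1 ∘ₗ toFrame b H -
      LinearMap.mulLeft F δ ∘ₗ LinearMap.proj (R := F) (φ := fun _ : Fin 3 => K) 0 ∘ₗ toFrame b H
  have hf : ∀ w, f w = toFrame b H w 2 - θ * τ (toFrame b H w 1) - δ * toFrame b H w 0 :=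
    fun w => rfl
  let g : LinearMap.ker f →ₗ[F] F × K :=
    (LinearMap.snd F (Fin 3 → F) F ∘ₗ LinearMap.snd F (Fin 3 → F) ((Fin 3 → F) × F) ∘ₗ
      (LinearMap.ker f).subtype).prod
    (LinearMap.proj (R := F) (φ := fun _ : Fin 3 => K) 1 ∘ₗ toFrame b H ∘ₗ
      (LinearMap.ker f).subtype)
  have hg : Function.Injective g := by
    rw [← LinearMap.ker_eq_bot, LinearMap.ker_eq_bot']
    rintro ⟨w, hw⟩ h0
    have h1 : w.2.2 = 0 := congrArg Prod.fst h0
    have h2 : toFrame b H w 1 = 0 := congrArg Prod.snd h0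
    have h3 : toFrame b H w 0 = 0 := by rw [hH.toFrame_zero, h1, map_zero]
    rw [LinearMap.mem_ker, hf, h2, h3] at hw
    apply Subtype.ext
    apply hH.toFrame_injective (b := b)
    rw [Submodule.coe_zero, map_zero]
    ext i
    fin_cases i
    · exact h3
    · exact h2
    · simpa using hw
  have hker : Module.finrank F (LinearMap.ker f) ≤ 4 := by
    refine (LinearMap.finrank_le_finrank_of_injective hg).trans ?_
    rw [Module.finrank_prod, hdeg.out, Module.finrank_self]
  have hspace : (hH.cubic b hD hpr u v).space = LinearMap.ker f := by
    apply Submodule.eq_of_le_of_finrank_le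
    · rw [TwistedCubic.space, Submodule.span_le]
      rintro _ ⟨n, rfl⟩
      rw [SetLike.mem_coe, LinearMap.mem_ker, hf, IsFrame.cubic, hH.toFrame_formVec]
      simp only [Matrix.cons_val]
      linear_combination hrel n
    · rw [TwistedCubic.space, finrank_span_eq_card (hH.cubic b hD hpr u v).indep]
      simpa using hker
  rw [hspace]
  intro w hw
  obtain ⟨h0, h2⟩ := mem_graphPlane.1 hw
  rw [LinearMap.mem_ker, hf, h0, h2, twist_apply]
  ring

/-- At the root of `L_l`, only the forms `L_p² L_r` and `L_u² L_v` without conjugate factor `L_l`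
survive; if these are the coordinates `β_{ρ i}` and `γᵢ`, the point lies on their coordinate line. -/
theorem IsFrame.isSpecialCubic_cubic (hH : IsFrame F H π) {y₀ y₁ : K}
    (hD : conjDet F y₀ y₁ ≠ 0) {p r : Fin 3} (hpr : p ≠ r) {u v : Fin 3} {τ : K ≃ₐ[F] K} {θ δ : K}
    (hrel : ∀ n, formCoeff F y₀ y₁ u u v n =
      θ * τ (formCoeff F y₀ y₁ p p r n) + δ * formCoeff F y₀ y₁ 0 1 2 n)
    {X : Set (Submodule F (Vec7 F))} (hX : graphPlane b H (twist θ τ) ∈ X) {ρ : Fin 3 → Fin 3}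
    (htr : transversals K X = Set.range fun i => coordLine b H (ρ i) i)
    (hroot : ∀ i, ∃ l, l ≠ p + ρ i ∧ l ≠ r + ρ i ∧ (∀ k, k ≠ ρ i → p + k = l ∨ r + k = l) ∧
      ∀ k, k ≠ i → u + k = l ∨ v + k = l) :
    IsSpecialCubic K X (hH.cubic b hD hpr u v) := by
  refine ⟨fun hle => ?_, ⟨_, hX, hH.graphPlane_le_space hD hpr hrel⟩, ?_, ?_⟩
  · have h0 := hle (Submodule.subset_span ⟨0, rfl⟩)
    rw [hH.mem_sigmaInfinity_iff (b := b), IsFrame.cubic, hH.toFrame_formVec] at h0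
    have hy : y₀ ≠ 0 := by rintro rfl; simp [conjDet] at hD
    simp [formCoeff, hy] at h0
  · rw [htr, hH.ncard_range_coordLine]
  · rw [htr]
    rintro _ ⟨i, rfl⟩
    obtain ⟨l, h1, h2, h3, h4⟩ := hroot i
    have hcoord := hH.extFrame_cubicVec (b := b) y₀ y₁ p r u v (conj F K l y₁) (-conj F K l y₀)
    refine ⟨Projectivization.mk K
      (cubicVec (fun n => extendVec K (formVec b H y₀ y₁ p r u v n)) (conj F K l y₁)
        (-conj F K l y₀)) (fun h0 => ?_), ⟨_, _, _, rfl⟩, ?_⟩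
    · rw [h0, map_zero] at hcoord
      have := congrFun (congrArg Prod.fst hcoord) (ρ i)
      simp [conjForm_ne_zero hD h1, conjForm_ne_zero hD h2] at this
    · rw [mk_onSubspace_iff, mem_coordLine, hcoord]
      refine ⟨fun k hk => ?_, fun k hk => ?_, ?_⟩
      · rcases h3 k hk with h | h <;> simp only [h, conjForm_root] <;> ring
      · rcases h4 k hk with h | h <;> simp only [h, conjForm_root] <;> ring
      · exact conjForm_zero_mul_one_mul_two_root y₀ y₁ l

/-- A point of the cubic with parameters `s, t` in `F`, in terms of `y = s y₀ + t y₁`. -/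
theorem cubicVec_formVec (y₀ y₁ : K) (p r u v : Fin 3) (s t : F) :
    cubicVec (formVec b H y₀ y₁ p r u v) s t =
      ofFrame b H ![conjNorm F (s • y₀ + t • y₁),
        conj F K p (s • y₀ + t • y₁) ^ 2 * conj F K r (s • y₀ + t • y₁),
        conj F K u (s • y₀ + t • y₁) ^ 2 * conj F K v (s • y₀ + t • y₁)] := by
  have hform : ∀ i, conj F K i (s • y₀ + t • y₁) =
      conjForm F y₀ y₁ i (algebraMap F K s) (algebraMap F K t) := fun i => by
    simp [conjForm, Algebra.smul_def]
  have hN : conjNorm F (s • y₀ + t • y₁) =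
      conj F K 0 (s • y₀ + t • y₁) * conj F K 1 (s • y₀ + t • y₁) *
        conj F K 2 (s • y₀ + t • y₁) := rfl
  rw [hN]
  simp only [cubicVec, formVec, ← map_smul, ← map_add, hform, pow_two, ← formCoeff_eval]
  congr 1
  ext i
  fin_cases i <;> simp [Algebra.smul_def]

/-- If the cubic forms are `N(y)` times the coordinates of the affine point of `π` with parameter
`x(y)`, then the points of the cubic are these points, for the `y` with `Tr(κ y) = 0`. -/
theorem IsFrame.points_cubic_eq (hH : IsFrame F H π) {κ y₀ y₁ : K} (hκ : κ ≠ 0)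
    (hD : conjDet F y₀ y₁ ≠ 0) (h₀ : conjTrace F κ y₀ = 0) (h₁ : conjTrace F κ y₁ = 0)
    {p r : Fin 3} (hpr : p ≠ r) (u v : Fin 3) {x : K → K}
    (hβ : ∀ y, y ≠ 0 → conj F K p y ^ 2 * conj F K r y = conjNorm F y * (σ (x y) / x y))
    (hγ : ∀ y, y ≠ 0 → conj F K u y ^ 2 * conj F K v y = conjNorm F y * (σ (σ (x y)) / x y)) :
    (hH.cubic b hD hpr u v).points = {R | ∃ y : K, y ≠ 0 ∧ conjTrace F κ y = 0 ∧
      R = Projectivization.mk F _ (affineVec_ne_zero (b := b) (H := H) (x y))} := by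
  have key : ∀ s t : F, s • y₀ + t • y₁ ≠ 0 → ∃ c : F, c ≠ 0 ∧
      cubicVec (formVec b H y₀ y₁ p r u v) s t = c • affineVec b H (x (s • y₀ + t • y₁)) := by
    intro s t hy
    rw [cubicVec_formVec]
    set y := s • y₀ + t • y₁
    obtain ⟨c, hc⟩ := exists_algebraMap_eq_conjNorm (F := F) y
    refine ⟨c, ?_, ?_⟩
    · rintro rfl
      rw [map_zero] at hc
      exact hy (conjNorm_eq_zero.1 hc.symm)
    · rw [affineVec, ← map_smul, hβ y hy, hγ y hy, ← hc]
      congr 1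
      ext i
      fin_cases i <;> simp [Algebra.smul_def]
  ext R
  constructor
  · rintro ⟨s, t, h, rfl⟩
    have hy : s • y₀ + t • y₁ ≠ 0 := by
      intro h0
      apply h
      obtain ⟨rfl, rfl⟩ := eq_zero_of_smul_add_smul_eq_zero hD h0
      simp [cubicVec]
    obtain ⟨c, hc0, hc⟩ := key s t hy
    refine ⟨_, hy, conjTrace_smul_add_smul h₀ h₁ s t, ?_⟩
    exact (Projectivization.mk_eq_mk_iff' F _ _ _ _).2 ⟨c, hc.symm⟩
  · rintro ⟨y, hy, hty, rfl⟩
    obtain ⟨s, t, rfl⟩ := exists_eq_smul_add_smul hκ hD h₀ h₁ hty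
    obtain ⟨c, hc0, hc⟩ := key s t hy
    have hne : cubicVec (formVec b H y₀ y₁ p r u v) s t ≠ 0 := by
      rw [hc]
      exact smul_ne_zero hc0 (affineVec_ne_zero _)
    refine ⟨s, t, hne, ?_⟩
    symm
    exact (Projectivization.mk_eq_mk_iff' F _ _ _ _).2 ⟨c, hc.symm⟩

/-! ### The fixed points and the special conics -/

/-- A homography that fixes `π` and the line at infinity is diagonal in adapted coordinates. If it
maps `(x, σ x, σ² x)` to a multiple of `(y, σ y, σ² y)`, then its coordinate forms `c x`, `s(x)`,
`t(x)` satisfy `t(x) σ(c x) = s(x) σ(s(x))`, and the coefficients of this identity decide. -/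
theorem IsFrame.exists_apply_single_eq_smul (hH : IsFrame F H π) {g : Vec3 K ≃ₗ[K] Vec3 K}
    (hg : homography g '' π = π)
    (hl : (lineAtInfinity K).map g.toLinearMap = lineAtInfinity K) (i : Fin 3) :
    ∃ l : K, g (H (Pi.single i 1)) = l • H (Pi.single i 1) := by
  let g' : Vec3 K ≃ₗ[K] Vec3 K := H.trans (g.trans H.symm)
  have hg' : ∀ X, H (g' X) = g (H X) := fun X => H.apply_symm_apply _
  have hexp : ∀ X j, g' X j = X 0 * g' (Pi.single 0 1) j + X 1 * g' (Pi.single 1 1) j +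
      X 2 * g' (Pi.single 2 1) j := fun X j => by
    have hX : X = X 0 • (Pi.single 0 1 : Vec3 K) + X 1 • (Pi.single 1 1 : Vec3 K) +
        X 2 • (Pi.single 2 1 : Vec3 K) := by
      ext k; fin_cases k <;> simp
    conv_lhs => rw [hX]
    simp only [map_add, map_smul, Pi.add_apply, Pi.smul_apply, smul_eq_mul]
  have hinf : ∀ X : Vec3 K, X 0 = 0 → g' X 0 = 0 := fun X hX => by
    have h1 : H X ∈ lineAtInfinity K := by rw [mem_lineAtInfinity, hH.apply_two, hX]
    have h2 : g (H X) ∈ lineAtInfinity K := by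
      rw [← hl]
      exact Submodule.mem_map_of_mem h1
    rwa [← hg', mem_lineAtInfinity, hH.apply_two] at h2
  have h01 : g' (Pi.single 1 1) 0 = 0 := hinf _ (by simp)
  have h02 : g' (Pi.single 2 1) 0 = 0 := hinf _ (by simp)
  have himg : ∀ x : K, x ≠ 0 → ∃ m y : K, y ≠ 0 ∧ g' (frobVec F x) = m • frobVec F y := by
    intro x hx
    have hmem : homography g (Projectivization.mk K _ (apply_frobVec_ne_zero (F := F)
        (H := H) hx)) ∈ π := by
      rw [← hg]
      exact ⟨_, (hH.mem_iff _).2 ⟨x, _, rfl⟩, rfl⟩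
    obtain ⟨y, hy, hxy⟩ := (hH.mem_iff _).1 hmem
    rw [homography, Projectivization.map_mk, Projectivization.mk_eq_mk_iff'] at hxy
    obtain ⟨m, hm⟩ := hxy
    refine ⟨m, y, ?_, ?_⟩
    · rintro rfl
      apply hy
      rw [frobVec_zero, map_zero]
    · apply H.injective
      rw [hg', map_smul, hm]
      rfl
  set c := g' (Pi.single 0 1) 0 with hc
  set a := g' (Pi.single 0 1) 1 with ha
  set e := g' (Pi.single 1 1) 1 with he
  set d := g' (Pi.single 2 1) 1 with hd
  set a₂ := g' (Pi.single 0 1) 2 with ha₂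
  set e₂ := g' (Pi.single 1 1) 2 with he₂
  set d₂ := g' (Pi.single 2 1) 2 with hd₂
  have hcoord : ∀ x, g' (frobVec F x) 0 = c * x ∧
      g' (frobVec F x) 1 = a * x + e * σ x + d * σ (σ x) ∧
      g' (frobVec F x) 2 = a₂ * x + e₂ * σ x + d₂ * σ (σ x) := fun x => by
    refine ⟨?_, ?_, ?_⟩ <;> rw [hexp] <;>
      simp only [frobVec, Matrix.cons_val, h01, h02] <;> ring
  have hc0 : c ≠ 0 := by
    obtain ⟨m, y, hy, hm⟩ := himg 1 one_ne_zero
    have h0 := congrFun hm 0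
    rw [(hcoord 1).1] at h0
    rintro h
    rw [h, zero_mul] at h0
    have hm0 : m = 0 := (mul_eq_zero.1 h0.symm).resolve_right hy
    rw [hm0, zero_smul, LinearEquiv.map_eq_zero_iff] at hm
    exact frobVec_ne_zero one_ne_zero hm
  have hid : ∀ x : K, (-(a * σ d)) * x ^ 2 + (e₂ * σ c - e * σ a) * σ x ^ 2 +
      (-(d * σ e)) * σ (σ x) ^ 2 + (d₂ * σ c - e * σ e - d * σ a) * (σ x * σ (σ x)) +
      (-(a * σ e) - d * σ d) * (x * σ (σ x)) + (a₂ * σ c - a * σ a - e * σ d) * (x * σ x) = 0 := by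
    intro x
    by_cases hx : x = 0
    · simp [hx]
    obtain ⟨m, y, hy, hm⟩ := himg x hx
    obtain ⟨k0, k1, k2⟩ := hcoord x
    rw [hm] at k0 k1 k2
    have k0 : m * y = c * x := k0
    have k1 : m * σ y = a * x + e * σ x + d * σ (σ x) := k1
    have k2 : m * σ (σ y) = a₂ * x + e₂ * σ x + d₂ * σ (σ x) := k2
    have k0' := congrArg (frob F K) k0
    have k1' := congrArg (frob F K) k1
    simp only [map_add, map_mul, frob_cube] at k0' k1'
    linear_combination -(σ c * σ x) * k2 - m * σ (σ y) * k0' +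
      (σ a * σ x + σ e * σ (σ x) + σ d * x) * k1 + m * σ y * k1'
  obtain ⟨q1, q2, q3, q4, q5, q6⟩ := eq_zero_of_forall_quadratic hid
  have hσ : ∀ {z : K}, σ z = 0 → z = 0 := fun h => by simpa using h
  have hσc : σ c ≠ 0 := fun h => hc0 (hσ h)
  have hd0 : d = 0 := by
    by_contra hd0
    have hσd : σ d ≠ 0 := fun h => hd0 (hσ h)
    have ha0 : a = 0 := by simpa [hσd] using q1
    rw [ha0] at q5
    simp [hd0] at q5
  rw [hd0] at q1 q3 q4 q5 q6
  have he0 : e ≠ 0 := by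
    intro he0
    rw [he0] at q2
    have he₂0 : e₂ = 0 := by simpa [hσc] using q2
    have : g' (Pi.single 1 1) = 0 := by
      ext k
      fin_cases k <;> assumption
    rw [LinearEquiv.map_eq_zero_iff] at this
    simpa using congrFun this 1
  have hσe : σ e ≠ 0 := fun h => he0 (hσ h)
  have ha0 : a = 0 := by simpa [hσe] using q5
  rw [ha0] at q2 q4 q6
  have he₂0 : e₂ = 0 := by simpa [hσc] using q2
  have ha₂0 : a₂ = 0 := by simpa [hσc] using q6
  have key : ∃ l : K, g' (Pi.single i 1) = l • Pi.single i 1 := by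
    fin_cases i
    · refine ⟨c, ?_⟩
      ext k; fin_cases k
      · simpa using hc.symm
      · simpa using ha0
      · simpa using ha₂0
    · refine ⟨e, ?_⟩
      ext k; fin_cases k
      · simpa using h01
      · simpa using he.symm
      · simpa using he₂0
    · refine ⟨d₂, ?_⟩
      ext k; fin_cases k
      · simpa using h02
      · simpa using hd0
      · simpa using hd₂.symm
  obtain ⟨l, hl⟩ := key
  exact ⟨l, by rw [← hg', hl, map_smul]⟩

theorem IsFrame.mk_single_mem_fixedPoints (hH : IsFrame F H π) (i : Fin 3)
    (hi : H (Pi.single i 1) ≠ 0) :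
    Projectivization.mk K _ hi ∈ fixedPoints π (lineAtInfinity K) := by
  intro g hg hl
  obtain ⟨l, hgl⟩ := hH.exists_apply_single_eq_smul hg hl i
  rw [homography, Projectivization.map_mk, Projectivization.mk_eq_mk_iff']
  exact ⟨l, hgl.symm⟩

/-- Expansion of a ternary quadratic form along three vectors. -/
theorem aeval_linear_combination {k L : Type*} [Field k] [Field L] [Algebra k L]
    {Q : MvPolynomial (Fin 3) k} (hQ : Q.IsHomogeneous 2) (A₀ A₁ A₂ : Fin 3 → L) (x₀ x₁ x₂ : L) :
    MvPolynomial.aeval (x₀ • A₀ + x₁ • A₁ + x₂ • A₂) Q =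
      x₀ ^ 2 * MvPolynomial.aeval A₀ Q + x₁ ^ 2 * MvPolynomial.aeval A₁ Q +
      x₂ ^ 2 * MvPolynomial.aeval A₂ Q +
      x₀ * x₁ * (MvPolynomial.aeval (A₀ + A₁) Q - MvPolynomial.aeval A₀ Q -
        MvPolynomial.aeval A₁ Q) +
      x₀ * x₂ * (MvPolynomial.aeval (A₀ + A₂) Q - MvPolynomial.aeval A₀ Q -
        MvPolynomial.aeval A₂ Q) +
      x₁ * x₂ * (MvPolynomial.aeval (A₁ + A₂) Q - MvPolynomial.aeval A₁ Q -
        MvPolynomial.aeval A₂ Q) := by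
  simp only [MvPolynomial.aeval_def, MvPolynomial.eval₂_eq', ← Finset.sum_sub_distrib,
    Finset.mul_sum, ← Finset.sum_add_distrib]
  refine Finset.sum_congr rfl fun m hm => ?_
  have hdeg := hQ (MvPolynomial.mem_support_iff.1 hm)
  have hsum : m 0 + m 1 + m 2 = 2 := by
    rw [Finsupp.weight_apply, Finsupp.sum_fintype _ _ (by simp), Fin.sum_univ_three] at hdeg
    simpa using hdeg
  simp only [Fin.prod_univ_three, Pi.add_apply, Pi.smul_apply, smul_eq_mul]
  have hcases : (m 0 = 2 ∧ m 1 = 0 ∧ m 2 = 0) ∨ (m 0 = 0 ∧ m 1 = 2 ∧ m 2 = 0) ∨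
      (m 0 = 0 ∧ m 1 = 0 ∧ m 2 = 2) ∨ (m 0 = 1 ∧ m 1 = 1 ∧ m 2 = 0) ∨
      (m 0 = 1 ∧ m 1 = 0 ∧ m 2 = 1) ∨ (m 0 = 0 ∧ m 1 = 1 ∧ m 2 = 1) := by omega
  rcases hcases with ⟨h0, h1, h2⟩ | ⟨h0, h1, h2⟩ | ⟨h0, h1, h2⟩ | ⟨h0, h1, h2⟩ | ⟨h0, h1, h2⟩ |
    ⟨h0, h1, h2⟩ <;> rw [h0, h1, h2] <;> ring

theorem aeval_smul {k L : Type*} [Field k] [Field L] [Algebra k L]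
    {Q : MvPolynomial (Fin 3) k} (hQ : Q.IsHomogeneous 2) (c : L) (A : Fin 3 → L) :
    MvPolynomial.aeval (c • A) Q = c ^ 2 * MvPolynomial.aeval A Q := by
  have := aeval_linear_combination hQ A 0 0 c 0 0
  simpa using this

/-- A special conic of `π` has an equation `Tr(κ / x) = 0` in the parameter `x` of `π`. Its
quadratic form vanishes at the coordinate points, so it is a combination of the products of two
different conjugates of `x`, and it takes values in `F`. -/
theorem exists_special_conic_equation {h : Vec3 K ≃ₗ[K] Vec3 K} {d : Module.Basis (Fin 3) F K}
    (hH : IsFrame F ((conjEquiv d).symm.trans h) π) {Q : MvPolynomial (Fin 3) F} (hQ0 : Q ≠ 0)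
    (hQ : Q.IsHomogeneous 2) (hfix : fixedPoints π (lineAtInfinity K) ⊆ extendedConic h Q) :
    ∃ κ : K, κ ≠ 0 ∧ ∀ (x : K) (hx : ((conjEquiv d).symm.trans h) (frobVec F x) ≠ 0),
      Projectivization.mk K _ hx ∈ extendedConic h Q ↔ conjTrace F κ x⁻¹ = 0 := by
  set H := (conjEquiv d).symm.trans h with hHdef
  have hsymm : ∀ X, h.symm (H X) = (conjEquiv d).symm X := fun X => h.symm_apply_apply _
  have hmem : ∀ X (hX : H X ≠ 0), Projectivization.mk K _ hX ∈ extendedConic h Q ↔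
      MvPolynomial.aeval ((conjEquiv d).symm X) Q = 0 := by
    intro X hX
    obtain ⟨a, ha⟩ := Projectivization.exists_smul_eq_mk_rep K (H X) hX
    change MvPolynomial.aeval (h.symm (Projectivization.mk K (H X) hX).rep) Q = 0 ↔ _
    rw [← ha, Units.smul_def, map_smul, hsymm, aeval_smul hQ]
    simp
  let A (i : Fin 3) : Fin 3 → K := (conjEquiv d).symm (Pi.single i 1)
  have hA : ∀ i, MvPolynomial.aeval (A i) Q = 0 := fun i => by
    have hi : H (Pi.single i 1) ≠ 0 := by simp
    exact (hmem _ hi).1 (hfix (hH.mk_single_mem_fixedPoints i hi))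
  let u₀ := MvPolynomial.aeval (A 1 + A 2) Q
  let u₁ := MvPolynomial.aeval (A 0 + A 2) Q
  let u₂ := MvPolynomial.aeval (A 0 + A 1) Q
  have hform : ∀ X : Vec3 K, MvPolynomial.aeval ((conjEquiv d).symm X) Q =
      u₂ * (X 0 * X 1) + u₁ * (X 0 * X 2) + u₀ * (X 1 * X 2) := fun X => by
    have hX : X = X 0 • (Pi.single 0 1 : Vec3 K) + X 1 • (Pi.single 1 1 : Vec3 K) +
        X 2 • (Pi.single 2 1 : Vec3 K) := by
      ext k; fin_cases k <;> simp
    have : (conjEquiv d).symm X = X 0 • A 0 + X 1 • A 1 + X 2 • A 2 := by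
      conv_lhs => rw [hX]
      simp only [map_add, map_smul, A]
    rw [this, aeval_linear_combination hQ, hA, hA, hA]
    ring
  have hrat : ∀ x : K, (conjEquiv d).symm (frobVec F x) =
      fun i => algebraMap F K (d.equivFun x i) := fun x => by
    rw [LinearEquiv.symm_apply_eq, conjEquiv_algebraMap, LinearEquiv.symm_apply_apply]
    rfl
  have hfrob : ∀ x : K, 0 * x ^ 2 + 0 * σ x ^ 2 + 0 * σ (σ x) ^ 2 + (σ u₂ - u₀) * (σ x * σ (σ x)) +
      (σ u₀ - u₁) * (x * σ (σ x)) + (σ u₁ - u₂) * (x * σ x) = 0 := fun x => by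
    have h1 := hform (frobVec F x)
    have h2 : σ (MvPolynomial.aeval ((conjEquiv d).symm (frobVec F x)) Q) =
        MvPolynomial.aeval ((conjEquiv d).symm (frobVec F x)) Q := by
      rw [hrat, show (fun i => algebraMap F K (d.equivFun x i)) =
        (algebraMap F K ∘ (d.equivFun x)) from rfl, MvPolynomial.aeval_algebraMap_apply]
      exact AlgEquiv.commutes _ _
    rw [h1] at h2
    simp only [frobVec, Matrix.cons_val, map_add, map_mul, frob_cube] at h2
    linear_combination h2
  obtain ⟨-, -, -, k0, k1, k2⟩ := eq_zero_of_forall_quadratic hfrob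
  have hu₁ : u₁ = σ u₀ := (sub_eq_zero.1 k1).symm
  have hu₂ : u₂ = σ (σ u₀) := by rw [← hu₁, sub_eq_zero.1 k2]
  refine ⟨u₀, fun h0 => hQ0 ?_, fun x hx => ?_⟩
  · apply hQ.eq_zero_of_forall_eval_eq_zero_of_le_card
    · intro c
      apply (algebraMap F K).injective
      have h1 := hform (conjEquiv d (algebraMap F K ∘ c))
      rw [LinearEquiv.symm_apply_apply, hu₁, hu₂, h0] at h1
      rw [map_zero, ← MvPolynomial.coe_aeval_eq_eval]
      have h2 := MvPolynomial.aeval_algebraMap_apply (B := K) c Q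
      rw [h1] at h2
      simpa using h2.symm
    · have : 1 < Nat.card F := Finite.one_lt_card
      rw [← Nat.cast_card]
      exact_mod_cast this
  · have hx0 : x ≠ 0 := by
      rintro rfl
      apply hx
      rw [frobVec_zero, map_zero]
    have h1 : σ x ≠ 0 := by simpa using hx0
    have h2 : σ (σ x) ≠ 0 := by simpa using hx0
    rw [hmem, hform, hu₁, hu₂]
    have : σ (σ u₀) * (frobVec F x 0 * frobVec F x 1) + σ u₀ * (frobVec F x 0 * frobVec F x 2) +
        u₀ * (frobVec F x 1 * frobVec F x 2) = conjNorm F x * conjTrace F u₀ x⁻¹ := by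
      simp only [frobVec, conjNorm, conjTrace, Matrix.cons_val, map_inv₀]
      field_simp
      ring
    rw [this, mul_eq_zero, conjNorm_eq_zero]
    simp [hx0]

/-! ### Lines of the subplane and its tangent cover -/

theorem IsFrame.twistPlanes_one_subset_spread (hH : IsFrame F H π) :
    twistPlanes b H 1 ⊆ spread b := by
  rw [← hH.splashPlanes_eq]
  exact Set.image_mono fun T hT => hT.1

theorem one_ne_two_fin : (1 : Fin 3) ≠ 2 := by decide

/-- A line of `π` corresponds to a twisted cubic that is special with respect to the spread. -/
theorem IsFrame.isSpecialCubic_line (hH : IsFrame F H π) {k x₀ x₁ : K} (hk : k ≠ 0)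
    (hD : conjDet F x₀ x₁ ≠ 0) (h₀ : conjTrace F k x₀ = 0) (h₁ : conjTrace F k x₁ = 0) :
    IsSpecialCubic K (spread b) (hH.cubic b hD one_ne_two_fin 2 1) := by
  have hk1 : σ k ≠ 0 := by simpa using hk
  have hk2 : σ (σ k) ≠ 0 := by simpa using hk
  -- `γ = θ β + δ z` is the relation `Tr(k x) = 0`, multiplied by `σ(x) σ²(x) / σ²(k)`.
  refine hH.isSpecialCubic_cubic (τ := 1) (θ := -(σ k / σ (σ k))) (δ := -(k / σ (σ k))) hD
    one_ne_two_fin (fun n => ?_) (hH.twistPlanes_one_subset_spread ⟨_, ?_, rfl⟩) (ρ := id)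
    hH.transversals_spread (by decide)
  · simp only [conjTrace] at h₀ h₁
    fin_cases n <;> simp only [formCoeff, conj_zero, conj_one, conj_two, AlgEquiv.one_apply,
      Fin.zero_eta, Fin.mk_one, Fin.reduceFinMk, Matrix.cons_val] <;> field_simp
    · linear_combination σ x₀ * σ (σ x₀) * h₀
    · linear_combination σ x₀ * σ (σ x₀) * h₁ + (σ x₀ * σ (σ x₁) + σ x₁ * σ (σ x₀)) * h₀
    · linear_combination σ x₁ * σ (σ x₁) * h₀ + (σ x₀ * σ (σ x₁) + σ x₁ * σ (σ x₀)) * h₁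
    · linear_combination σ x₁ * σ (σ x₁) * h₁
  · simp only [Set.mem_ofPred_eq, conjNorm, map_neg, map_div₀, frob_cube]
    field_simp

theorem IsFrame.points_line (hH : IsFrame F H π) {k x₀ x₁ : K} (hk : k ≠ 0)
    (hD : conjDet F x₀ x₁ ≠ 0) (h₀ : conjTrace F k x₀ = 0) (h₁ : conjTrace F k x₁ = 0) :
    (hH.cubic b hD one_ne_two_fin 2 1).points =
      bruckBose b {Q | Q ∈ π ∧ OnSubspace Q (lineOf F H k)} := by
  rw [hH.points_cubic_eq hk hD h₀ h₁ one_ne_two_fin 2 1 (x := id)]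
  · ext R
    rw [hH.mem_bruckBose_iff fun Q hQ => hQ.1]
    constructor
    · rintro ⟨y, hy, hty, rfl⟩
      refine ⟨y, hy, ⟨(hH.mem_iff _).2 ⟨y, _, rfl⟩, ?_⟩, rfl⟩
      rwa [mk_onSubspace_iff, apply_frobVec_mem_lineOf]
    · rintro ⟨y, hy, ⟨-, hty⟩, rfl⟩
      rw [mk_onSubspace_iff, apply_frobVec_mem_lineOf] at hty
      exact ⟨y, hy, hty, rfl⟩
  · intro y hy
    simp only [conj_one, conj_two, conjNorm, id]
    field_simp
  · intro y hy
    simp only [conj_one, conj_two, conjNorm, id]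
    field_simp

theorem formVec_one_zero (v : K) (p r u w : Fin 3) :
    formVec b H 1 v p r u w 0 = affineVec b H 1 := by
  simp [formVec, formCoeff, affineVec]

/-- The tangent plane at the point of `π` with parameter `1` contains the points
`(0, σ(v) - v, σ²(v) - v)`. -/
theorem IsFrame.ofFrame_mem_tangentPlane (hH : IsFrame F H π) {v : K} (hv : σ v ≠ v)
    (h1 : H (frobVec F 1) ≠ 0) :
    ofFrame b H ![0, σ v - v, σ (σ v) - v] ∈
      tangentPlane b π (Projectivization.mk K _ h1) := by
  have hD : conjDet F 1 v ≠ 0 := by simpa [conjDet, sub_eq_zero] using hv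
  -- `Tr(k x) = 0` with `k = σ²(v) - σ(v)` is the line of `π` through the parameters `1` and `v`.
  have hk : σ (σ v) - σ v ≠ 0 := sub_ne_zero.2 fun e => hv ((frob F K).injective e)
  have h₀ : conjTrace F (σ (σ v) - σ v) 1 = 0 := by
    simp only [conjTrace, map_sub, map_one, frob_cube]; ring
  have h₁ : conjTrace F (σ (σ v) - σ v) v = 0 := by
    simp only [conjTrace, map_sub, frob_cube]; ring
  set N := hH.cubic b hD one_ne_two_fin 2 1 with hN
  have hNm : ∀ n, N.m n = formVec b H 1 v 1 2 2 1 n := fun n => rfl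
  have hpt : cubicVec N.m (1 : F) 0 = affineVec b H 1 := by
    simp [cubicVec, hNm, formVec_one_zero]
  have hne : cubicVec N.m (1 : F) 0 ≠ 0 := by
    rw [hpt]
    exact affineVec_ne_zero 1
  have hP : Projectivization.mk K _ h1 ∈ π := (hH.mem_iff _).2 ⟨1, h1, rfl⟩
  have hle : N.tangent (1 : F) 0 ≤ tangentPlane b π (Projectivization.mk K _ h1) := by
    refine le_sSup ⟨lineOf F H (σ (σ v) - σ v), N, 1, 0, hne, hH.isExtendedLine_lineOf hk, ?_,
      hH.isSpecialCubic_line hk hD h₀ h₁, hH.points_line hk hD h₀ h₁, ?_, rfl⟩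
    · rwa [mk_onSubspace_iff, apply_frobVec_mem_lineOf]
    · ext R
      rw [hH.mem_bruckBose_iff (Set.singleton_subset_iff.2 hP), Set.mem_singleton_iff]
      constructor
      · rintro ⟨x, hx, hmk, rfl⟩
        rw [Set.mem_singleton_iff, Projectivization.mk_eq_mk_iff'] at hmk
        obtain ⟨a, ha⟩ := hmk
        rw [← map_smul] at ha
        have ha' := H.injective ha
        have e0 : a * 1 = x := congrFun ha' 0
        have e1 : a * σ 1 = σ x := congrFun ha' 1
        have e2 : a * σ (σ 1) = σ (σ x) := congrFun ha' 2
        simp only [map_one, mul_one] at e0 e1 e2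
        congr 1
        rw [hpt, affineVec, affineVec, ← e2, ← e1, e0, div_self hx]
        simp
      · rintro rfl
        refine ⟨1, one_ne_zero, rfl, ?_⟩
        congr 1
  apply hle
  -- `c` is the trace of `v`, the last coordinate of the derivative of the parametrisation.
  obtain ⟨c, hc⟩ := exists_algebraMap_eq_formCoeff (F := F) 1 v 1
  have hw : ofFrame b H ![0, σ v - v, σ (σ v) - v] = N.m 1 - c • N.m 0 := by
    rw [hNm, hNm, formVec, formVec, ← map_smul, ← map_sub]
    congr 1
    have hc' : algebraMap F K c = σ (σ v) + σ v + v := by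
      rw [← hc]; simp [formCoeff]
    ext i
    fin_cases i <;> simp [formCoeff, Algebra.smul_def, hc'] <;> ring
  rw [hw]
  refine Submodule.sub_mem _ (Submodule.subset_span ?_)
    (Submodule.smul_mem _ _ (Submodule.subset_span ?_))
  · right; right
    simp
  · left
    simp [cubicVec]

/-- The planes `γ = θ σ(β)` are not the tangent cover: a plane of this kind that contains all
`(0, σ(v) - v, σ²(v) - v)` would give a linear relation between `v`, `σ v`, `σ² v`. -/
theorem IsFrame.not_isTangentCover (hH : IsFrame F H π) :
    ¬ IsTangentCover b π (twistPlanes b H (frob F K)) := by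
  rintro ⟨-, hT⟩
  have h1 : H (frobVec F 1) ≠ 0 := apply_frobVec_ne_zero one_ne_zero
  obtain ⟨_, ⟨θ, hθ, rfl⟩, hle⟩ := hT _ ((hH.mem_iff _).2 ⟨1, h1, rfl⟩)
  have key : ∀ v : K, (-1) * v + θ * σ v + (1 - θ) * σ (σ v) = 0 := fun v => by
    by_cases hv : σ v = v
    · rw [hv, hv]; ring
    · have := hle ⟨hH.ofFrame_mem_tangentPlane hv h1, by
        rw [SetLike.mem_coe, hH.mem_sigmaInfinity_iff (b := b), hH.toFrame_ofFrame_zero]; rfl⟩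
      simp only at this
      rw [hH.ofFrame_mem_graphPlane, twist_apply, map_sub] at this
      linear_combination this
  exact neg_ne_zero.2 one_ne_zero (eq_zero_of_forall_linear key).1

theorem IsFrame.conicCover_eq (hH : IsFrame F H π) {X : Set (Submodule F (Vec7 F))}
    (hX : IsConicCover b π X) : X = twistPlanes b H (frob F K) := by
  obtain ⟨hXc, T, hT, hne⟩ := hX
  rcases hH.cover_eq hT.1 with rfl | rfl
  · exact absurd hT hH.not_isTangentCover
  · exact (hH.cover_eq hXc).resolve_right hne

/-! ### Special conics and special twisted cubics -/

theorem zero_ne_two_fin : (0 : Fin 3) ≠ 2 := by decide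

/-- The points with `Tr(κ / x) = 0` form a twisted cubic in the parameter `y = 1 / x`. -/
theorem IsFrame.isSpecialCubic_conic (hH : IsFrame F H π) {κ y₀ y₁ : K} (hκ : κ ≠ 0)
    (hD : conjDet F y₀ y₁ ≠ 0) (h₀ : conjTrace F κ y₀ = 0) (h₁ : conjTrace F κ y₁ = 0) :
    IsSpecialCubic K (twistPlanes b H (frob F K)) (hH.cubic b hD zero_ne_two_fin 0 1) := by
  -- `γ = θ σ(β) + δ z` is the relation `Tr(κ y) = 0`, multiplied by `y σ(y) / κ`.
  refine hH.isSpecialCubic_cubic (τ := frob F K) (θ := -(σ κ / κ)) (δ := -(σ (σ κ) / κ)) hD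
    zero_ne_two_fin (fun n => ?_) ⟨_, ?_, rfl⟩ (ρ := fun i => i + 1)
    hH.transversals_twistPlanes_frob (by decide)
  · simp only [conjTrace] at h₀ h₁
    fin_cases n <;> simp only [formCoeff, conj_zero, conj_one, conj_two, map_add, map_mul, frob_cube,
      Fin.zero_eta, Fin.mk_one, Fin.reduceFinMk, Matrix.cons_val] <;> field_simp
    · linear_combination y₀ * σ y₀ * h₀
    · linear_combination y₀ * σ y₀ * h₁ + (y₀ * σ y₁ + y₁ * σ y₀) * h₀
    · linear_combination y₁ * σ y₁ * h₀ + (y₀ * σ y₁ + y₁ * σ y₀) * h₁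
    · linear_combination y₁ * σ y₁ * h₁
  · rw [Set.mem_ofPred_eq, conjNorm_neg, conjNorm_frob_div hκ]

theorem IsFrame.points_conic (hH : IsFrame F H π) {κ y₀ y₁ : K} (hκ : κ ≠ 0)
    (hD : conjDet F y₀ y₁ ≠ 0) (h₀ : conjTrace F κ y₀ = 0) (h₁ : conjTrace F κ y₁ = 0)
    {Y : Set (ℙ K (Vec3 K))} (hY : ∀ (x : K) (hx : H (frobVec F x) ≠ 0),
      Projectivization.mk K _ hx ∈ Y ↔ conjTrace F κ x⁻¹ = 0) :
    (hH.cubic b hD zero_ne_two_fin 0 1).points = bruckBose b (π ∩ Y) := by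
  rw [hH.points_cubic_eq hκ hD h₀ h₁ zero_ne_two_fin 0 1 (x := fun y => y⁻¹)]
  · ext R
    rw [hH.mem_bruckBose_iff Set.inter_subset_left]
    constructor
    · rintro ⟨y, hy, hty, rfl⟩
      refine ⟨y⁻¹, inv_ne_zero hy, ⟨(hH.mem_iff _).2 ⟨_, _, rfl⟩, ?_⟩, rfl⟩
      rwa [hY, inv_inv]
    · rintro ⟨x, hx, ⟨-, hx'⟩, rfl⟩
      rw [hY] at hx'
      refine ⟨x⁻¹, inv_ne_zero hx, hx', ?_⟩
      simp only [inv_inv]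
  all_goals
    intro y hy
    have hy1 : σ y ≠ 0 := by simpa using hy
    have hy2 : σ (σ y) ≠ 0 := by simpa using hy
    simp only [conj_zero, conj_one, conj_two, conjNorm, map_inv₀]
    field_simp

end Subplane

end BruckBose

end

/-- Let `π` be an order-`q`-subplane of `PG(2,q³)` exterior to the line at infinity, with conic cover
`CC`. Every `(π,ℓ∞)`-special conic of `π` corresponds in `PG(6,q)` to a `CC`-special twisted cubic. -/
theorem theorem3p4 {F K : Type*} [Field F] [Finite F] [Field K] [Algebra F K]
    (b : Module.Basis (Fin 3) F K)
    (π : Set (Projectivization K (BruckBose.Vec3 K)))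
    (hπ : BruckBose.IsSubplane F π)
    (hext : BruckBose.IsExteriorTo π (BruckBose.lineAtInfinity K))
    (CC : Set (Submodule F (BruckBose.Vec7 F)))
    (hCC : BruckBose.IsConicCover b π CC)
    (C : Set (Projectivization K (BruckBose.Vec3 K)))
    (hC : BruckBose.IsSpecialConic F π (BruckBose.lineAtInfinity K) C) :
    ∃ N : BruckBose.TwistedCubic F,
      N.points = BruckBose.bruckBose b C ∧ BruckBose.IsSpecialCubic K CC N := by
  have : Fact (Module.finrank F K = 3) := ⟨by simpa using Module.finrank_eq_card_basis b⟩
  obtain ⟨h, Q, hh, hQ0, hQ, hfix, rfl⟩ := hC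
  obtain ⟨d, hH⟩ := BruckBose.exists_isFrame hh hext
  obtain ⟨κ, hκ, hY⟩ := BruckBose.exists_special_conic_equation hH hQ0 hQ hfix
  obtain ⟨y₀, y₁, hD, h₀, h₁⟩ := BruckBose.exists_conjTrace_eq_zero (F := F) hκ
  rw [hH.conicCover_eq hCC]
  exact ⟨_, hH.points_conic hκ hD h₀ h₁ hY, hH.isSpecialCubic_conic hκ hD h₀ h₁⟩
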